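/- **Geometry.** Let $d\ge 2$, let $\Omega\subset\mathbb R^d$ be open and bounded, $Y=(0,1)^d$, and let $Y_0\subset Y$ be open. For $\varepsilon>0$ and $k\in\mathbb Z^d$ let $\varepsilon Y_0^k=\varepsilon(Y_0+k)$, let $\Omega_0^\varepsilon$ be the union of those sets $\varepsilon Y_0^k$ that are contained in $\Omega$, and put $\Omega^\varepsilon=\Omega\setminus\overline{\Omega_0^\varepsilon}$, $\Gamma^\varepsilon=\partial\Omega_0^\varepsilon$, $\Gamma^{ext}=\partial\Omega^\varepsilon\setminus\Gamma^\varepsilon$. Call $\varepsilon>0$ *admissible* if $\Omega^\varepsilon$ is (non-empty and) connected, $\Gamma^{ext}=\partial\Omega$, and the boundary of $\Omega^\varepsilon$ along $\Gamma^\varepsilon$ is piecewise regular in the following weak sense: for each $x\in\Gamma^\varepsilon$ there is a finite set $H\subset\mathbb R^d$ with $x+h\in\Omega^\varepsilon$ for all $h\in H$, such that for every $y\in\Omega^\varepsilon$ sufficiently close to $x$ some segment $[y,y+h]$, $h\in H$, lies in $\Omega^\varepsilon$. (A Lipschitz boundary, or one satisfying the cone condition, has this property.) Let $V^\varepsilon$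 be the space of all $v\in H^1(\Omega^\varepsilon)$ with $v=0$ on $\Gamma^{ext}$ (the closure in $H^1(\Omega^\varepsilon)$ of the functions that vanish near $\Gamma^{ext}$), and for $N\ge1$ let $\mathcal V^\varepsilon=(V^\varepsilon)^N$ with $\|u\|_{\mathcal V^\varepsilon}^2=\sum_{i=1}^N\int_{\Omega^\varepsilon}|\nabla u_i|^2dx$. Call $C>0$ a *Poincaré constant* of $V^\varepsilon$ if $\int_{\Omega^\varepsilon}|v|^2dx\le C\int_{\Omega^\varepsilon}|\nabla v|^2dx$ for all $v\in V^\varepsilon$. **Data.** Let $\alpha>0$; for $i=1,\dots,N$ let $d_i\in L^\infty(\mathbb R^d;\mathbb R^{d\times d})$ be $Y$-periodic with $d_i(y)\xi\cdot\xi\ge\alpha|\xi|^2$ for a.e. $y$ and all $\xi\in\mathbb R^d$, and put $d_i^\varepsilon(x)=d_i(x/\varepsilon)$. Let $R_i:\Omega^\varepsilon\times\mathbb R^N\to\mathbb R$ be Carathéodory functions (measurable in $x$, continuous in $p$ for a.e. $x$) with $R_i(\cdot,p)\in L^\infty(\Omega^\varepsilon)$ for each $p$, that are globally Lipschitz: $|R_i(x,p)-R_i(x,q)|\le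 L_i\sum_{j=1}^N|p_j-q_j|$ for a.e. $x$ and all $p,q\in\mathbb R^N$, with constants $L_i\ge0$. A weak solution of the problem with zero Neumann condition on $\Gamma^\varepsilon$ is a $u\in\mathcal V^\varepsilon$ with $$\sum_{i=1}^N\int_{\Omega^\varepsilon}\bigl(d_i^\varepsilon\nabla u_i\cdot\nabla\varphi_i-R_i(x,u)\varphi_i\bigr)\,dx=0\quad\text{for all }\varphi\in\mathcal V^\varepsilon .$$ **Theorem.** 1. For every admissible $\varepsilon$ the space $V^\varepsilon$ has a Poincaré constant. If $\overline{Y_0}\subset Y$, there is one $C>0$, independent of $\varepsilon$, that is a Poincaré constant of $V^\varepsilon$ for all admissible $\varepsilon$. 2. Let $\varepsilon$ be admissible, let $C_p$ be a Poincaré constant of $V^\varepsilon$, and suppose that $\kappa_p:=C_p\,\alpha^{-1}N\max_{1\le i\le N}L_i<1$. Then the problem with zero Neumann condition on $\Gamma^\varepsilon$ has exactly one weak solution $u\in\mathcal V^\varepsilon$. There is exactly one sequence $(u^n)_{n\ge0}$ in $\mathcal V^\varepsilon$ with $u^0=0$ and $$\sum_{i=1}^N\int_{\Omega^\varepsilon}\bigl(d_i^\varepsilon\nabla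 u_i^{n+1}\cdot\nabla\varphi_i-R_i(x,u^n)\varphi_i\bigr)\,dx=0\quad\text{for all }\varphi\in\mathcal V^\varepsilon,\ n\ge0,$$ and it satisfies $u^n\to u$ in $\mathcal V^\varepsilon$ and $$\|u^n-u\|_{\mathcal V^\varepsilon}\le\frac{\kappa_p^n}{1-\kappa_p}\,\|u^1\|_{\mathcal V^\varepsilon}\quad\text{for all }n\ge0 .$$ -/

import Mathlib

open MeasureTheory Set Filter Topology
open scoped ContDiff

noncomputable section

namespace Perforated

/-- The space `ℝ^d` with its Euclidean norm. -/
abbrev E (d : ℕ) : Type := EuclideanSpace ℝ (Fin d)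

/-! ### Sobolev spaces -/

/-- Pairs `(v, g)` of an `L²` function and an `L²` vector field on `G`
(an element of `H¹(G)` is such a pair in which `g` is the weak gradient of `v`). -/
abbrev L2Pair {d : ℕ} (G : Set (E d)) : Type :=
  Lp ℝ 2 (volume.restrict G) × Lp (E d) 2 (volume.restrict G)

/-- `g` is the weak gradient of `v` in the open set `G`:
`∫_G v ∂_j φ = - ∫_G g_j φ` for all `φ ∈ C_c^∞(G)` and all `j`. -/
def IsWeakGradient {d : ℕ} (G : Set (E d)) (v : E d → ℝ) (g : E d → E d) : Prop :=
  ∀ φ : E d → ℝ, ContDiff ℝ ∞ φ → HasCompactSupport φ → tsupport φ ⊆ G → ∀ j : Fin d,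
    ∫ x in G, v x * fderiv ℝ φ x (EuclideanSpace.single j 1) = - ∫ x in G, g x j * φ x

/-- A test function times a fixed continuous function is integrable against `L²`. -/
theorem integrable_mul_test {d : ℕ} {G : Set (E d)} {f : E d → ℝ}
    (hf : MemLp f 2 (volume.restrict G)) {ψ : E d → ℝ} (hψ : Continuous ψ)
    (hc : HasCompactSupport ψ) : Integrable (fun x => f x * ψ x) (volume.restrict G) :=
  hf.integrable_mul (q := 2) ((hψ.memLp_of_hasCompactSupport hc).restrict G)

theorem continuous_dir {d : ℕ} {φ : E d → ℝ} (hφ : ContDiff ℝ ∞ φ) (e : E d) :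
    Continuous (fun x => fderiv ℝ φ x e) :=
  (hφ.continuous_fderiv (by simp)).clm_apply continuous_const

theorem memLp_coord {d : ℕ} {G : Set (E d)} (g : Lp (E d) 2 (volume.restrict G)) (j : Fin d) :
    MemLp (fun x => g x j) 2 (volume.restrict G) :=
  (EuclideanSpace.proj j : E d →L[ℝ] ℝ).comp_memLp' (Lp.memLp g)

/-- The Sobolev space `H¹(G)`, as a subspace of `L²(G) × L²(G)^d`. The product topology
is the topology of the `H¹` norm. -/
def H1 {d : ℕ} (G : Set (E d)) : Submodule ℝ (L2Pair G) where
  carrier := {p | IsWeakGradient G p.1 p.2}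
  zero_mem' := by
    intro φ _ _ _ j
    have h1 : ((0 : L2Pair G).1 : E d → ℝ) =ᵐ[volume.restrict G] 0 := Lp.coeFn_zero _ _ _
    have h2 : ((0 : L2Pair G).2 : E d → E d) =ᵐ[volume.restrict G] 0 := Lp.coeFn_zero _ _ _
    rw [integral_congr_ae (g := fun _ => (0 : ℝ)) (by
        filter_upwards [h1] with x hx
        rw [hx, Pi.zero_apply, zero_mul]),
      integral_congr_ae (f := fun x => (0 : L2Pair G).2 x j * φ x) (g := fun _ => (0 : ℝ))
        (by
          filter_upwards [h2] with x hx
          rw [hx, Pi.zero_apply, PiLp.zero_apply, zero_mul])]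
    simp
  add_mem' := by
    intro p q hp hq φ hφ hc hs j
    have hc' : HasCompactSupport (fun x => fderiv ℝ φ x (EuclideanSpace.single j 1)) :=
      (hc.fderiv (𝕜 := ℝ)).comp_left (g := fun T : E d →L[ℝ] ℝ => T (EuclideanSpace.single j 1))
        (by simp)
    have h1 := Lp.coeFn_add p.1 q.1
    have h2 := Lp.coeFn_add p.2 q.2
    rw [integral_congr_ae (f := fun x => (p + q).1 x * _)
        (g := fun x => p.1 x * fderiv ℝ φ x (EuclideanSpace.single j 1)
          + q.1 x * fderiv ℝ φ x (EuclideanSpace.single j 1))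
        (by
          filter_upwards [h1] with x hx
          rw [Prod.fst_add, hx, Pi.add_apply, add_mul]),
      integral_congr_ae (f := fun x => (p + q).2 x j * φ x)
        (g := fun x => p.2 x j * φ x + q.2 x j * φ x)
        (by
          filter_upwards [h2] with x hx
          rw [Prod.snd_add, hx, Pi.add_apply, PiLp.add_apply, add_mul]),
      integral_add (integrable_mul_test (Lp.memLp p.1) (continuous_dir hφ _) hc')
        (integrable_mul_test (Lp.memLp q.1) (continuous_dir hφ _) hc'),
      integral_add (integrable_mul_test (memLp_coord p.2 j) hφ.continuous hc)
        (integrable_mul_test (memLp_coord q.2 j) hφ.continuous hc),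
      hp φ hφ hc hs j, hq φ hφ hc hs j]
    ring
  smul_mem' := by
    intro c p hp φ hφ hc hs j
    have h1 := Lp.coeFn_smul c p.1
    have h2 := Lp.coeFn_smul c p.2
    rw [integral_congr_ae (f := fun x => (c • p).1 x * _)
        (g := fun x => c * (p.1 x * fderiv ℝ φ x (EuclideanSpace.single j 1)))
        (by
          filter_upwards [h1] with x hx
          rw [Prod.smul_fst, hx, Pi.smul_apply, smul_eq_mul, mul_assoc]),
      integral_congr_ae (f := fun x => (c • p).2 x j * φ x)
        (g := fun x => c * (p.2 x j * φ x))
        (by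
          filter_upwards [h2] with x hx
          rw [Prod.smul_snd, hx, Pi.smul_apply, PiLp.smul_apply, smul_eq_mul, mul_assoc]),
      integral_const_mul, integral_const_mul, hp φ hφ hc hs j]
    ring

/-- The functions of `H¹(G)` that vanish (a.e.) near the set `S`. -/
def H1VanishingNear {d : ℕ} (G S : Set (E d)) : Submodule ℝ (L2Pair G) where
  carrier := {p | p ∈ H1 G ∧ ∃ U : Set (E d), IsOpen U ∧ S ⊆ U ∧
    ∀ᵐ x ∂(volume.restrict G), x ∈ U → p.1 x = 0}
  zero_mem' := ⟨zero_mem _, univ, isOpen_univ, subset_univ _, by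
    have h1 : ((0 : L2Pair G).1 : E d → ℝ) =ᵐ[volume.restrict G] 0 := Lp.coeFn_zero _ _ _
    filter_upwards [h1] with x hx _
    simpa using hx⟩
  add_mem' := by
    rintro p q ⟨hp, U, hU, hSU, hpU⟩ ⟨hq, W, hW, hSW, hqW⟩
    refine ⟨add_mem hp hq, U ∩ W, hU.inter hW, subset_inter hSU hSW, ?_⟩
    filter_upwards [Lp.coeFn_add p.1 q.1, hpU, hqW] with x hx h1 h2 hxUW
    rw [Prod.fst_add, hx, Pi.add_apply, h1 hxUW.1, h2 hxUW.2, add_zero]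
  smul_mem' := by
    rintro c p ⟨hp, U, hU, hSU, hpU⟩
    refine ⟨Submodule.smul_mem _ c hp, U, hU, hSU, ?_⟩
    filter_upwards [Lp.coeFn_smul c p.1, hpU] with x hx h1 hxU
    rw [Prod.smul_fst, hx, Pi.smul_apply, h1 hxU, smul_zero]

/-- The functions of `H¹(G)` that are zero on the boundary part `S`: the closure in `H¹(G)`
of the functions of `H¹(G)` that vanish near `S`. -/
def H1ZeroOn {d : ℕ} (G S : Set (E d)) : Submodule ℝ (L2Pair G) :=
  H1 G ⊓ (H1VanishingNear G S).topologicalClosure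

/-! ### The perforated domain -/

/-- The open unit cell `Y = (0,1)^d`. -/
def unitCell (d : ℕ) : Set (E d) := {y | ∀ j, 0 < y j ∧ y j < 1}

/-- The scaled and shifted set `ε Y₀^k = ε (Y₀ + k)`. -/
def hole {d : ℕ} (Y₀ : Set (E d)) (ε : ℝ) (k : Fin d → ℤ) : Set (E d) :=
  (fun y : E d => ε • (y + WithLp.toLp 2 (fun j => (k j : ℝ)))) '' Y₀

/-- The solid skeleton `Ω₀^ε`: the union of the sets `ε Y₀^k` contained in `Ω`. -/
def skeleton {d : ℕ} (Ω Y₀ : Set (E d)) (ε : ℝ) : Set (E d) :=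
  ⋃ k ∈ {k : Fin d → ℤ | hole Y₀ ε k ⊆ Ω}, hole Y₀ ε k

/-- The pore space `Ω^ε`. -/
def poreSpace {d : ℕ} (Ω Y₀ : Set (E d)) (ε : ℝ) : Set (E d) :=
  Ω \ closure (skeleton Ω Y₀ ε)

/-- The pore surface `Γ^ε`. -/
def poreSurface {d : ℕ} (Ω Y₀ : Set (E d)) (ε : ℝ) : Set (E d) :=
  frontier (skeleton Ω Y₀ ε)

/-- The exterior boundary `Γ^ext`. -/
def extBoundary {d : ℕ} (Ω Y₀ : Set (E d)) (ε : ℝ) : Set (E d) :=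
  frontier (poreSpace Ω Y₀ ε) \ poreSurface Ω Y₀ ε

/-- The only regularity of the boundary of `G` that is used at `x`: there are finitely many
vectors `h` with `x + h ∈ G` such that from each point `y ∈ G` close to `x` at least one of the
segments `[y, y + h]` stays in `G`. One vector is enough where the boundary is the graph of a
continuous (for instance smooth or Lipschitz) function with `G` on one side; finitely many are
enough at edges, corners and cusps of piecewise smooth boundaries, and under the cone condition. -/
def PiecewiseRegularAt {d : ℕ} (G : Set (E d)) (x : E d) : Prop :=
  ∃ H : Finset (E d), (∀ h ∈ H, x + h ∈ G) ∧
    ∀ᶠ y in 𝓝[G] x, ∃ h ∈ H, segment ℝ y (y + h) ⊆ G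

/-- Standing assumptions on the perforated domain at the scale `ε`: it is connected, the
perforations do not touch the exterior boundary (`Γ^ext` coincides with `∂Ω`), and the
boundary along `Γ^ε` is piecewise regular. -/
structure AdmissibleScale {d : ℕ} (Ω Y₀ : Set (E d)) (ε : ℝ) : Prop where
  pos : 0 < ε
  connected : IsConnected (poreSpace Ω Y₀ ε)
  ext_eq : extBoundary Ω Y₀ ε = frontier Ω
  regular : ∀ x ∈ poreSurface Ω Y₀ ε, PiecewiseRegularAt (poreSpace Ω Y₀ ε) x

/-- The space `V^ε` of functions in `H¹(Ω^ε)` that are zero on `Γ^ext`. -/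
def V {d : ℕ} (Ω Y₀ : Set (E d)) (ε : ℝ) : Submodule ℝ (L2Pair (poreSpace Ω Y₀ ε)) :=
  H1ZeroOn (poreSpace Ω Y₀ ε) (extBoundary Ω Y₀ ε)

/-- The product space `𝒱^ε = V^ε × ... × V^ε`. -/
abbrev VProd {d : ℕ} (Ω Y₀ : Set (E d)) (ε : ℝ) (N : ℕ) : Type := Fin N → V Ω Y₀ ε

/-- The function underlying an element of `V^ε`. -/
def val {d : ℕ} {Ω Y₀ : Set (E d)} {ε : ℝ} (v : V Ω Y₀ ε) : E d → ℝ := v.1.1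

/-- The weak gradient of an element of `V^ε`. -/
def grad {d : ℕ} {Ω Y₀ : Set (E d)} {ε : ℝ} (v : V Ω Y₀ ε) : E d → E d := v.1.2

/-- The norm of `𝒱^ε`: `‖u‖² = ∑ i, ∫_{Ω^ε} |∇u_i|²`. -/
def vNorm {d : ℕ} {Ω Y₀ : Set (E d)} {ε : ℝ} {N : ℕ} (u : VProd Ω Y₀ ε N) : ℝ :=
  Real.sqrt (∑ i, ∫ x in poreSpace Ω Y₀ ε, ‖grad (u i) x‖ ^ 2)

/-- `C` is a Poincaré constant of `V^ε`: `∫ |v|² ≤ C ∫ |∇v|²` for all `v ∈ V^ε`. -/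
def IsPoincareConstant {d : ℕ} (Ω Y₀ : Set (E d)) (ε C : ℝ) : Prop :=
  0 < C ∧ ∀ v : V Ω Y₀ ε, ∫ x in poreSpace Ω Y₀ ε, (val v x) ^ 2
    ≤ C * ∫ x in poreSpace Ω Y₀ ε, ‖grad v x‖ ^ 2

/-! ### Data and problems -/

/-- A bounded, `Y`-periodic, uniformly elliptic (not necessarily symmetric) matrix field. -/
structure IsDiffusion {d : ℕ} (α : ℝ) (A : E d → (E d →L[ℝ] E d)) : Prop where
  bounded : MemLp A ⊤ volume
  periodic : ∀ j : Fin d, ∀ᵐ y, A (y + EuclideanSpace.single j 1) = A y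
  elliptic : ∀ᵐ y, ∀ ξ : E d, α * ‖ξ‖ ^ 2 ≤ inner ℝ (A y ξ) ξ

/-- A Carathéodory function on `G × ℝ^N`, essentially bounded in `x`. -/
structure IsCaratheodory {d N : ℕ} (G : Set (E d)) (R : E d → (Fin N → ℝ) → ℝ) : Prop where
  measurable : ∀ p, AEStronglyMeasurable (fun x => R x p) (volume.restrict G)
  continuous : ∀ᵐ x ∂(volume.restrict G), Continuous (R x)
  bounded : ∀ p, ∃ M : ℝ, ∀ᵐ x ∂(volume.restrict G), |R x p| ≤ M

/-- `R(x, ·)` is globally Lipschitz on `ℝ^N` with constant `L`, uniformly in `x`, for the norm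
`∑ j, |p_j|` (the weakest such requirement among the usual norms of `ℝ^N`). -/
def IsGloballyLipschitz {d N : ℕ} (G : Set (E d)) (L : ℝ) (R : E d → (Fin N → ℝ) → ℝ) : Prop :=
  0 ≤ L ∧ ∀ᵐ x ∂(volume.restrict G), ∀ p q : Fin N → ℝ, |R x p - R x q| ≤ L * ∑ j, |p j - q j|

/-- `u ∈ 𝒱^ε` is a weak solution of `-∇·(d_i^ε ∇u_i) = f_i` in `Ω^ε` with zero Neumann condition
on `Γ^ε` and zero Dirichlet condition on `Γ^ext`, where `d_i^ε(x) = d_i(x/ε)`. -/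
def SolvesLinear {d : ℕ} {Ω Y₀ : Set (E d)} {ε : ℝ} {N : ℕ}
    (D : Fin N → E d → (E d →L[ℝ] E d)) (f : Fin N → E d → ℝ) (u : VProd Ω Y₀ ε N) : Prop :=
  ∀ φ : VProd Ω Y₀ ε N,
    ∑ i, ∫ x in poreSpace Ω Y₀ ε,
      (inner ℝ (D i (ε⁻¹ • x) (grad (u i) x)) (grad (φ i) x) - f i x * val (φ i) x) = 0

/-- The reaction terms `x ↦ R_i(x, u(x))`. -/
def reaction {d : ℕ} {Ω Y₀ : Set (E d)} {ε : ℝ} {N : ℕ}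
    (R : Fin N → E d → (Fin N → ℝ) → ℝ) (u : VProd Ω Y₀ ε N) : Fin N → E d → ℝ :=
  fun i x => R i x (fun j => val (u j) x)

/-- `u ∈ 𝒱^ε` is a weak solution of the semilinear problem with zero Neumann condition
on `Γ^ε`. -/
def IsWeakSolution {d : ℕ} {Ω Y₀ : Set (E d)} {ε : ℝ} {N : ℕ}
    (D : Fin N → E d → (E d →L[ℝ] E d)) (R : Fin N → E d → (Fin N → ℝ) → ℝ)
    (u : VProd Ω Y₀ ε N) : Prop :=
  SolvesLinear D (reaction R u) u

/-- The Picard iteration: `u⁰ = 0`, and `u^{n+1}` is a weak solution of the linear problem with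
right-hand side `R_i(·, u^n)`. -/
def IsPicard {d : ℕ} {Ω Y₀ : Set (E d)} {ε : ℝ} {N : ℕ}
    (D : Fin N → E d → (E d →L[ℝ] E d)) (R : Fin N → E d → (Fin N → ℝ) → ℝ)
    (U : ℕ → VProd Ω Y₀ ε N) : Prop :=
  U 0 = 0 ∧ ∀ n, SolvesLinear D (reaction R (U n)) (U (n + 1))

end Perforated

end

/-! Poincaré inequality. Neither extension operators nor Rellich's theorem are needed; everything
rests on one translation estimate, `IsSobolev.eLpNorm_translate_sub_le`: if all segments `[y, y +
h]`, `y ∈ A`, lie in the open set `M`, then `F(· + h) - F` is bounded in `L²(A)` by `‖h‖` times the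
`L²(M)` norm of the weak gradient. Hence an `L²` bound on `A + h` gives one on `A`. A function that
vanishes near `∂Ω` extends by zero to `M`, the complement of the closed skeleton
(`IsSobolev.extend_by_zero`), so `Ωᶜ`, where the extension is zero, is the source from which bounds
spread.

At a fixed scale, the points with a controlled ball form a relatively clopen subset of `M`. Control
enters the pore space through `∂Ω`, spreads by connectedness, and reaches `Γ^ε` through the finitely
many vectors of the regularity condition; compactness leaves one constant (`controlled_poreSpace`).

For a constant independent of the scale, the neighbourhoods of the grid planes ("slabs") are free of
perforations. Since `d ≥ 2`, each slab contains a direction in which a translation by more than the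
size of `Ω` stays in the slab and ends where the function is zero. Inside a cell the function is
controlled by its values near the faces, with a constant from the unit cell; rescaling only
multiplies the gradient term by `ε²`. The cells are disjoint, so the estimates add up
(`lintegral_poreSpace_le`), and `ε` is bounded as soon as one nonempty perforation fits into `Ω`.
The unit cell estimate itself is extracted from a single admissible scale
(`AdmissibleScale.controlled_cell`).

Nonlinear problem. By Poincaré, the gradient identifies `V^ε` with a closed subspace of `L²`, a
Hilbert space in which Lax–Milgram solves the linear problems. Testing the difference of two linear
solutions with itself, and using Poincaré once for the test function and once for the Lipschitz
right-hand side, shows that the solution map is a contraction with factor `κ`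
(`vNorm_sub_le_of_solvesLinear`). Banach's fixed point theorem gives the rest. -/

noncomputable section

namespace Perforated

variable {d : ℕ}

/-! ### Sobolev functions on open sets and translations -/

/-- `F` is a square integrable function on `M` with square integrable weak gradient `g`. -/
structure IsSobolev (M : Set (E d)) (F : E d → ℝ) (g : E d → E d) : Prop where
  memLp : MemLp F 2 (volume.restrict M)
  memLp_grad : MemLp g 2 (volume.restrict M)
  weak : IsWeakGradient M F g

theorem abs_integral_inner_le {X H : Type*} [MeasurableSpace X] {μ : Measure X}
    [NormedAddCommGroup H] [InnerProductSpace ℝ H] {u v : X → H}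
    (hu : MemLp u 2 μ) (hv : MemLp v 2 μ) :
    |∫ x, inner ℝ (u x) (v x) ∂μ| ≤ (eLpNorm u 2 μ).toReal * (eLpNorm v 2 μ).toReal := by
  have h := norm_inner_le_norm (𝕜 := ℝ) (hu.toLp u) (hv.toLp v)
  rw [L2.inner_def, Lp.norm_toLp, Lp.norm_toLp, Real.norm_eq_abs] at h
  refine le_trans (le_of_eq ?_) h
  congr 1
  refine integral_congr_ae ?_
  filter_upwards [hu.coeFn_toLp, hv.coeFn_toLp] with x h1 h2
  rw [h1, h2]

theorem hasCompactSupport_fderiv_apply {φ : E d → ℝ} (hc : HasCompactSupport φ) (v : E d) :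
    HasCompactSupport (fun x => fderiv ℝ φ x v) :=
  (hc.fderiv (𝕜 := ℝ)).comp_left (g := fun T : E d →L[ℝ] ℝ => T v) (by simp)

/-- The classes of the test functions in `L²(A)`. -/
def testSubspace (A : Set (E d)) : Submodule ℝ (Lp ℝ 2 (volume.restrict A)) where
  carrier := {f | ∃ φ : E d → ℝ, ContDiff ℝ ∞ φ ∧ HasCompactSupport φ ∧ tsupport φ ⊆ A ∧
    f =ᵐ[volume.restrict A] φ}
  zero_mem' := ⟨0, contDiff_const, HasCompactSupport.zero, by simp, Lp.coeFn_zero _ _ _⟩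
  add_mem' := by
    rintro f g ⟨φ, h1, h2, h3, h4⟩ ⟨ψ, k1, k2, k3, k4⟩
    exact ⟨φ + ψ, h1.add k1, h2.add k2,
      (closure_mono (Function.support_add φ ψ)).trans
        (by rw [closure_union]; exact union_subset h3 k3),
      (Lp.coeFn_add f g).trans (h4.add k4)⟩
  smul_mem' := by
    rintro c f ⟨φ, h1, h2, h3, h4⟩
    exact ⟨c • φ, contDiff_const.smul h1, h2.smul_left (f := fun _ => c),
      (closure_mono (Function.support_const_smul_subset c φ)).trans h3,
      (Lp.coeFn_smul c f).trans (h4.const_smul c)⟩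

theorem memLp_test {φ : E d → ℝ} (h1 : ContDiff ℝ ∞ φ) (h2 : HasCompactSupport φ) :
    MemLp φ 2 volume :=
  h1.continuous.memLp_of_hasCompactSupport h2

/-- An element orthogonal to all test functions is zero by the fundamental lemma of the calculus of
variations. -/
theorem testSubspace_closure_eq_top {A : Set (E d)} (hA : IsOpen A) :
    (testSubspace A).topologicalClosure = ⊤ := by
  rw [Submodule.topologicalClosure_eq_top_iff, eq_bot_iff]
  intro f hf
  rw [Submodule.mem_bot]
  have key : ∀ᵐ x ∂(volume.restrict A), x ∈ A → f x = 0 := by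
    refine hA.ae_eq_zero_of_integral_contDiff_smul_eq_zero
      (((Lp.memLp f).locallyIntegrable (by norm_num)).locallyIntegrableOn A) ?_
    intro φ h1 h2 h3
    have hφ := (memLp_test h1 h2).restrict A
    have h4 := hf (hφ.toLp φ) ⟨φ, h1, h2, h3, hφ.coeFn_toLp⟩
    rw [L2.inner_def] at h4
    rw [← h4]
    refine integral_congr_ae ?_
    filter_upwards [hφ.coeFn_toLp] with x hx
    rw [hx]
    simp [mul_comm]
  refine (Lp.eq_zero_iff_ae_eq_zero).2 ?_
  filter_upwards [key, ae_restrict_mem hA.measurableSet] with x h1 h2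
  exact h1 h2

/-- The `L²` norm is controlled by testing with smooth functions. -/
theorem eLpNorm_le_of_test {A : Set (E d)} (hA : IsOpen A) {w : E d → ℝ}
    (hw : MemLp w 2 (volume.restrict A)) {c : ℝ} (hc : 0 ≤ c)
    (h : ∀ φ : E d → ℝ, ContDiff ℝ ∞ φ → HasCompactSupport φ → tsupport φ ⊆ A →
      |∫ x in A, w x * φ x| ≤ c * (eLpNorm φ 2 (volume.restrict A)).toReal) :
    eLpNorm w 2 (volume.restrict A) ≤ ENNReal.ofReal c := by
  set W := hw.toLp w
  have hcl : IsClosed {f : Lp ℝ 2 (volume.restrict A) | |inner ℝ W f| ≤ c * ‖f‖} :=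
    isClosed_le (by fun_prop) (by fun_prop)
  have hsub : (testSubspace A : Set (Lp ℝ 2 (volume.restrict A))) ⊆
      {f | |inner ℝ W f| ≤ c * ‖f‖} := by
    rintro f ⟨φ, h1, h2, h3, h4⟩
    have h5 := h φ h1 h2 h3
    rw [mem_ofPred_eq, Lp.norm_def, eLpNorm_congr_ae h4, L2.inner_def]
    refine le_trans (le_of_eq ?_) h5
    congr 1
    refine integral_congr_ae ?_
    filter_upwards [hw.coeFn_toLp, h4] with x h6 h7
    rw [h6, h7]
    simp [mul_comm]
  -- By density the hypothesis may be tested with `w` itself, which gives `‖w‖² ≤ c ‖w‖`.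
  have hW : W ∈ (testSubspace A).topologicalClosure := by
    rw [testSubspace_closure_eq_top hA]; trivial
  have h6 : |inner ℝ W W| ≤ c * ‖W‖ := closure_minimal hsub hcl hW
  rw [real_inner_self_eq_norm_sq, abs_of_nonneg (by positivity), sq] at h6
  have h7 : ‖W‖ ≤ c := by
    by_cases h0 : ‖W‖ = 0
    · rw [h0]; exact hc
    · exact le_of_mul_le_mul_right h6 (lt_of_le_of_ne (norm_nonneg _) (Ne.symm h0))
  rw [Lp.norm_toLp] at h7
  exact (ENNReal.le_ofReal_iff_toReal_le hw.eLpNorm_ne_top hc).2 h7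

theorem sum_coord_smul_single (v : E d) : v = ∑ j, v j • EuclideanSpace.single j (1 : ℝ) := by
  ext i
  simp [Finset.sum_apply, Pi.single_apply]

theorem inner_eq_sum_coord (a v : E d) : inner ℝ a v = ∑ j, v j * a j := by
  simp [PiLp.inner_apply]

/-- The weak gradient in an arbitrary direction. -/
theorem IsSobolev.integral_mul_fderiv {M : Set (E d)} {F : E d → ℝ} {g : E d → E d}
    (hF : IsSobolev M F g) {φ : E d → ℝ} (h1 : ContDiff ℝ ∞ φ) (h2 : HasCompactSupport φ)
    (h3 : tsupport φ ⊆ M) (v : E d) :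
    ∫ x in M, F x * fderiv ℝ φ x v = - ∫ x in M, inner ℝ (g x) v * φ x := by
  have e1 : ∀ x, F x * fderiv ℝ φ x v =
      ∑ j, v j * (F x * fderiv ℝ φ x (EuclideanSpace.single j 1)) := by
    intro x
    conv_lhs => rw [sum_coord_smul_single v]
    simp only [map_sum, map_smul, smul_eq_mul, Finset.mul_sum]
    exact Finset.sum_congr rfl fun j _ => by ring
  have e2 : ∀ x, inner ℝ (g x) v * φ x = ∑ j, v j * (g x j * φ x) := by
    intro x
    rw [inner_eq_sum_coord, Finset.sum_mul]
    exact Finset.sum_congr rfl fun j _ => by ring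
  simp_rw [e1, e2]
  rw [integral_finsetSum, integral_finsetSum, ← Finset.sum_neg_distrib]
  · refine Finset.sum_congr rfl fun j _ => ?_
    rw [integral_const_mul, integral_const_mul, hF.weak φ h1 h2 h3 j, mul_neg]
  · intro j _
    exact (integrable_mul_test ((EuclideanSpace.proj j : E d →L[ℝ] ℝ).comp_memLp' hF.memLp_grad)
      h1.continuous h2).const_mul _
  · intro j _
    exact (integrable_mul_test hF.memLp (continuous_dir h1 _)
      (hasCompactSupport_fderiv_apply h2 _)).const_mul _

/-- Tube lemma for the compact parameter interval `[0, 1]`. -/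
theorem isOpen_segment_subset {M : Set (E d)} (hM : IsOpen M) (h : E d) :
    IsOpen {y : E d | segment ℝ y (y + h) ⊆ M} := by
  have e : {y : E d | segment ℝ y (y + h) ⊆ M} = {y | ∀ t ∈ Icc (0 : ℝ) 1, y + t • h ∈ M} := by
    ext y
    rw [mem_ofPred_eq, segment_eq_image', image_subset_iff, add_sub_cancel_left]
    rfl
  rw [e, isOpen_iff_mem_nhds]
  intro y hy
  refine isCompact_Icc.eventually_forall_of_forall_eventually (x₀ := y)
    (P := fun y t => y + t • h ∈ M) fun t ht => ?_
  have hc : Continuous (fun p : E d × ℝ => p.1 + p.2 • h) := by fun_prop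
  exact hc.continuousAt.preimage_mem_nhds (hM.mem_nhds (hy t ht))

theorem tsupport_comp_sub (φ : E d → ℝ) (c : E d) :
    tsupport (fun z => φ (z - c)) = (fun z => z - c) ⁻¹' tsupport φ :=
  tsupport_comp_eq_preimage φ (Homeomorph.subRight c)

/-- The shift acts on the smooth factor, so no regularity of `F` beyond `L²` is needed to
differentiate under the integral. -/
theorem hasDerivAt_integral_translate {M : Set (E d)} {F : E d → ℝ}
    (hF : MemLp F 2 (volume.restrict M)) {φ : E d → ℝ} (h1 : ContDiff ℝ ∞ φ)
    (h2 : HasCompactSupport φ) (h : E d) (t : ℝ) :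
    HasDerivAt (fun s : ℝ => ∫ z in M, F z * φ (z - s • h))
      (- ∫ z in M, F z * fderiv ℝ φ (z - t • h) h) t := by
  obtain ⟨R, hR⟩ := h2.isCompact.isBounded.subset_closedBall 0
  have hcs := hasCompactSupport_fderiv_apply h2 h
  obtain ⟨C, hC⟩ := hcs.exists_bound_of_continuous (continuous_dir h1 h)
  -- A ball that contains the supports of all `φ(· - s h)` with `|s - t| < 1`; on it `F` is
  -- integrable, which yields the dominating function.
  set K : Set (E d) := Metric.closedBall 0 (R + (|t| + 1) * ‖h‖)
  have htr : ∀ (ψ : E d → ℝ) (s : ℝ), Continuous ψ → HasCompactSupport ψ →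
      Integrable (fun z => F z * ψ (z - s • h)) (volume.restrict M) := fun ψ s hψ hψc =>
    integrable_mul_test hF (hψ.comp (continuous_id.sub continuous_const))
      (hψc.comp_homeomorph (Homeomorph.subRight (s • h)))
  have hbi : Integrable (fun z => C * ‖K.indicator F z‖) (volume.restrict M) := by
    refine Integrable.const_mul (Integrable.norm ?_) _
    rw [integrable_indicator_iff Metric.isClosed_closedBall.measurableSet]
    have : IsFiniteMeasure ((volume.restrict M).restrict K) :=
      ⟨by
        rw [Measure.restrict_apply_univ]
        exact (Measure.restrict_apply_le _ _).trans_lt measure_closedBall_lt_top⟩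
    exact (hF.restrict K).integrable (by norm_num)
  have key := hasDerivAt_integral_of_dominated_loc_of_deriv_le (μ := volume.restrict M)
    (F := fun (s : ℝ) z => F z * φ (z - s • h))
    (F' := fun (s : ℝ) z => -(F z * fderiv ℝ φ (z - s • h) h))
    (bound := fun z => C * ‖K.indicator F z‖) (x₀ := t) (Metric.ball_mem_nhds t one_pos)
    (Eventually.of_forall fun s => (htr φ s h1.continuous h2).aestronglyMeasurable)
    (htr φ t h1.continuous h2)
    (htr _ t (continuous_dir h1 h) hcs).neg.aestronglyMeasurable
    (Eventually.of_forall fun z s hs => ?_) hbi (Eventually.of_forall fun z s _ => ?_)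
  · have := key.2
    rwa [integral_neg] at this
  · by_cases hz : z ∈ K
    · rw [indicator_of_mem hz, norm_neg, norm_mul, mul_comm]
      exact mul_le_mul_of_nonneg_right (hC _) (norm_nonneg _)
    · have h0 : fderiv ℝ φ (z - s • h) h = 0 := by
        by_contra hne
        apply hz
        have hm : z - s • h ∈ tsupport φ :=
          support_fderiv_subset ℝ (fun h0 => hne (by rw [h0]; rfl))
        have h5 := hR hm
        rw [mem_closedBall_zero_iff] at h5 ⊢
        have h6 : |s| ≤ |t| + 1 := by
          have := hs
          rw [Metric.mem_ball, Real.dist_eq] at this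
          have h7 := abs_sub_abs_le_abs_sub s t
          linarith
        calc ‖z‖ = ‖(z - s • h) + s • h‖ := by rw [sub_add_cancel]
          _ ≤ ‖z - s • h‖ + ‖s • h‖ := norm_add_le _ _
          _ ≤ R + (|t| + 1) * ‖h‖ := by
            rw [norm_smul, Real.norm_eq_abs]
            gcongr
      rw [h0, indicator_of_notMem hz]
      simp
  · have hφ := (h1.differentiable (by simp)).differentiableAt (x := z - s • h)
    have hl : HasDerivAt (fun s : ℝ => z - s • h) (-h) s := by
      simpa using ((hasDerivAt_id s).smul_const h).const_sub z
    have := (hφ.hasFDerivAt.comp_hasDerivAt s hl).const_mul (F z)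
    simpa using this

/-- Slide the test function along `h`. For each `t ∈ [0, 1]` its shifted support stays in `M`, so
the derivative in `t` can be rewritten with the weak gradient and bounded by Cauchy–Schwarz; the
mean value inequality integrates the bound. -/
theorem IsSobolev.abs_integral_translate_sub_le {M : Set (E d)} {F : E d → ℝ} {g : E d → E d}
    (hF : IsSobolev M F g) {φ : E d → ℝ} (h1 : ContDiff ℝ ∞ φ) (h2 : HasCompactSupport φ)
    {h : E d} (h3 : tsupport φ ⊆ {y | segment ℝ y (y + h) ⊆ M}) :
    |(∫ z in M, F z * φ (z - h)) - ∫ z in M, F z * φ z| ≤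
      ‖h‖ * (eLpNorm g 2 (volume.restrict M)).toReal * (eLpNorm φ 2 volume).toReal := by
  set a : ℝ → ℝ := fun s => ∫ z in M, F z * φ (z - s • h)
  have hda := hasDerivAt_integral_translate hF.memLp h1 h2 h
  have hb : ∀ t ∈ Ico (0 : ℝ) 1, ‖(- ∫ z in M, F z * fderiv ℝ φ (z - t • h) h : ℝ)‖ ≤
      ‖h‖ * (eLpNorm g 2 (volume.restrict M)).toReal * (eLpNorm φ 2 volume).toReal := by
    intro t ht
    set ψ : E d → ℝ := fun z => φ (z - t • h)
    have hψ1 : ContDiff ℝ ∞ ψ := h1.comp (contDiff_id.sub contDiff_const)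
    have hψ2 : HasCompactSupport ψ := h2.comp_homeomorph (Homeomorph.subRight (t • h))
    have hψ3 : tsupport ψ ⊆ M := by
      intro z hz
      rw [tsupport_comp_sub] at hz
      refine h3 hz ?_
      rw [segment_eq_image']
      exact ⟨t, ⟨ht.1, ht.2.le⟩, by simp⟩
    have e1 : ∀ z, fderiv ℝ φ (z - t • h) = fderiv ℝ ψ z := fun z => (fderiv_comp_sub _).symm
    simp_rw [e1]
    rw [hF.integral_mul_fderiv hψ1 hψ2 hψ3, neg_neg]
    have e2 : ∀ z, inner ℝ (g z) h * ψ z = inner ℝ (g z) (ψ z • h) := fun z => by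
      rw [real_inner_smul_right, mul_comm]
    simp_rw [e2]
    have hψL := (memLp_test hψ1 hψ2).restrict M
    have hm : MemLp (fun z => ψ z • h) 2 (volume.restrict M) :=
      (ContinuousLinearMap.toSpanSingleton ℝ h).comp_memLp' hψL
    refine (abs_integral_inner_le hF.memLp_grad hm).trans ?_
    have hn : (eLpNorm (fun z => ψ z • h) 2 (volume.restrict M)).toReal ≤
        ‖h‖ * (eLpNorm φ 2 volume).toReal := by
      have e3 : eLpNorm (fun z => ψ z • h) 2 (volume.restrict M) ≤
          ENNReal.ofReal ‖h‖ * eLpNorm ψ 2 (volume.restrict M) :=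
        eLpNorm_le_mul_eLpNorm_of_ae_le_mul
          (Eventually.of_forall fun z => by rw [norm_smul, mul_comm]) 2
      have e4 : eLpNorm ψ 2 volume = eLpNorm φ 2 volume :=
        eLpNorm_comp_measurePreserving h1.continuous.aestronglyMeasurable
          (measurePreserving_sub_right volume (t • h))
      have e5 := e3.trans (mul_le_mul_right ((eLpNorm_mono_measure ψ Measure.restrict_le_self).trans
        e4.le) _)
      have e6 := ENNReal.toReal_mono (ENNReal.mul_ne_top ENNReal.ofReal_ne_top
        (memLp_test h1 h2).eLpNorm_ne_top) e5
      rwa [ENNReal.toReal_mul, ENNReal.toReal_ofReal (norm_nonneg _)] at e6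
    calc _ ≤ (eLpNorm g 2 (volume.restrict M)).toReal * (‖h‖ * (eLpNorm φ 2 volume).toReal) := by
          gcongr
      _ = _ := by ring
  have := norm_image_sub_le_of_norm_deriv_le_segment_01'
    (fun t _ => (hda t).hasDerivWithinAt) hb
  simpa [a] using this

/-- Translations of Sobolev functions along segments contained in `M`. -/
theorem IsSobolev.eLpNorm_translate_sub_le {M : Set (E d)} (hM : IsOpen M) {F : E d → ℝ}
    {g : E d → E d} (hF : IsSobolev M F g) (h : E d) :
    MemLp (fun y => F (y + h)) 2 (volume.restrict {y | segment ℝ y (y + h) ⊆ M}) ∧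
    eLpNorm (fun y => F (y + h) - F y) 2 (volume.restrict {y | segment ℝ y (y + h) ⊆ M}) ≤
      ENNReal.ofReal ‖h‖ * eLpNorm g 2 (volume.restrict M) := by
  set A : Set (E d) := {y | segment ℝ y (y + h) ⊆ M}
  have hA : IsOpen A := isOpen_segment_subset hM h
  have hAM : A ⊆ M := fun y hy => hy (left_mem_segment ℝ _ _)
  have hAM' : ∀ y ∈ A, y + h ∈ M := fun y hy => hy (right_mem_segment ℝ _ _)
  have hind : MemLp (M.indicator F) 2 volume := (memLp_indicator_iff_restrict hM.measurableSet).2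
    hF.memLp
  have htrans : MemLp (fun y => F (y + h)) 2 (volume.restrict A) := by
    have h1 : MemLp (fun y => M.indicator F (y + h)) 2 (volume.restrict A) :=
      (hind.comp_measurePreserving (measurePreserving_add_right volume h)).restrict A
    refine h1.ae_eq ?_
    filter_upwards [ae_restrict_mem hA.measurableSet] with y hy
    exact indicator_of_mem (hAM' y hy) F
  have hFA : MemLp F 2 (volume.restrict A) := hF.memLp.mono_measure
    (Measure.restrict_mono hAM le_rfl)
  refine ⟨htrans, ?_⟩
  have hc : 0 ≤ ‖h‖ * (eLpNorm g 2 (volume.restrict M)).toReal := by positivity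
  have key := eLpNorm_le_of_test hA (htrans.sub hFA) hc ?_
  · rwa [ENNReal.ofReal_mul (norm_nonneg _),
      ENNReal.ofReal_toReal hF.memLp_grad.eLpNorm_ne_top] at key
  · intro φ h1 h2 h3
    have h4 := hF.abs_integral_translate_sub_le h1 h2 h3
    have hz : ∀ y, y ∉ A → φ y = 0 := fun y hy => image_eq_zero_of_notMem_tsupport
      fun hy' => hy (h3 hy')
    -- Translation invariance moves the shift from the test function back to `F`.
    have e1 : ∫ z in M, F z * φ (z - h) = ∫ y in A, F (y + h) * φ y := by
      rw [← integral_indicator hM.measurableSet, ← integral_indicator hA.measurableSet,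
        ← integral_add_right_eq_self _ h]
      congr 1
      ext y
      by_cases hy : y ∈ A
      · rw [indicator_of_mem hy, indicator_of_mem (hAM' y hy), add_sub_cancel_right]
      · rw [indicator_of_notMem hy]
        refine indicator_apply_eq_zero.2 fun _ => ?_
        rw [add_sub_cancel_right, hz y hy, mul_zero]
    have e2 : ∫ z in M, F z * φ z = ∫ y in A, F y * φ y := by
      rw [← integral_indicator hM.measurableSet, ← integral_indicator hA.measurableSet]
      congr 1
      ext y
      by_cases hy : y ∈ A
      · rw [indicator_of_mem hy, indicator_of_mem (hAM hy)]
      · rw [indicator_of_notMem hy]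
        refine indicator_apply_eq_zero.2 fun _ => ?_
        rw [hz y hy, mul_zero]
    have e3 : eLpNorm φ 2 volume = eLpNorm φ 2 (volume.restrict A) := by
      rw [← eLpNorm_indicator_eq_eLpNorm_restrict hA.measurableSet]
      congr 1
      ext y
      by_cases hy : y ∈ A
      · rw [indicator_of_mem hy]
      · rw [indicator_of_notMem hy, hz y hy]
    rw [e1, e2, e3, ← integral_sub (integrable_mul_test htrans h1.continuous h2)
      (integrable_mul_test hFA h1.continuous h2)] at h4
    simpa only [Pi.sub_apply, sub_mul] using h4

/-! ### Sets on which the `L²` norm is controlled by the gradient and by a base set -/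

open scoped NNReal ENNReal

theorem lintegral_enorm_sq {X H : Type*} [MeasurableSpace X] (μ : Measure X)
    [NormedAddCommGroup H] (f : X → H) :
    ∫⁻ x, ‖f x‖ₑ ^ 2 ∂μ = eLpNorm f 2 μ ^ 2 := by
  have := eLpNorm_nnreal_pow_eq_lintegral (f := f) (μ := μ) (p := 2) (by norm_num)
  simpa using this.symm

/-- The squared `L²(A)` norm of Sobolev functions on `M` is bounded by a multiple of their squared
`L²(B)` norm plus the squared `L²(M)` norm of their gradient. -/
def Controlled (M B A : Set (E d)) : Prop :=
  ∃ C : ℝ≥0, ∀ F g, IsSobolev M F g →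
    ∫⁻ x in A, ‖F x‖ₑ ^ 2 ≤ C * ((∫⁻ x in B, ‖F x‖ₑ ^ 2) + ∫⁻ x in M, ‖g x‖ₑ ^ 2)

theorem Controlled.mono {M B A A' : Set (E d)} (h : Controlled M B A) (hA : A' ⊆ A) :
    Controlled M B A' := by
  obtain ⟨C, hC⟩ := h
  exact ⟨C, fun F g hF => (lintegral_mono_set hA).trans (hC F g hF)⟩

theorem controlled_base (M B : Set (E d)) : Controlled M B B :=
  ⟨1, fun F g _ => by rw [ENNReal.coe_one, one_mul]; exact le_self_add⟩

theorem controlled_empty (M B : Set (E d)) : Controlled M B ∅ :=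
  (controlled_base M B).mono (empty_subset _)

theorem Controlled.union {M B A A' : Set (E d)} (h : Controlled M B A) (h' : Controlled M B A') :
    Controlled M B (A ∪ A') := by
  obtain ⟨C, hC⟩ := h
  obtain ⟨C', hC'⟩ := h'
  refine ⟨C + C', fun F g hF => (lintegral_union_le _ _ _).trans ?_⟩
  rw [ENNReal.coe_add, add_mul]
  exact add_le_add (hC F g hF) (hC' F g hF)

theorem controlled_biUnion {M B : Set (E d)} {ι : Type*} (s : Finset ι) {A : ι → Set (E d)}
    (h : ∀ i ∈ s, Controlled M B (A i)) : Controlled M B (⋃ i ∈ s, A i) := by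
  classical
  induction s using Finset.induction_on with
  | empty => simpa using controlled_empty M B
  | insert i s _ ih =>
    rw [Finset.set_biUnion_insert]
    exact (h i (Finset.mem_insert_self _ _)).union
      (ih fun j hj => h j (Finset.mem_insert_of_mem hj))

theorem enorm_sq_le_two_mul (a b : ℝ) : ‖b‖ₑ ^ 2 ≤ 2 * ‖a‖ₑ ^ 2 + 2 * ‖a - b‖ₑ ^ 2 := by
  have h : ‖b‖ ^ 2 ≤ 2 * ‖a‖ ^ 2 + 2 * ‖a - b‖ ^ 2 := by
    simp only [Real.norm_eq_abs, sq_abs]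
    -- The difference of the two sides is exactly `(2a - b)²`.
    nlinarith [sq_nonneg (2 * a - b)]
  have := ENNReal.ofReal_le_ofReal h
  rw [ENNReal.ofReal_add (by positivity) (by positivity), ENNReal.ofReal_mul (by norm_num),
    ENNReal.ofReal_mul (by norm_num), ENNReal.ofReal_pow (norm_nonneg _),
    ENNReal.ofReal_pow (norm_nonneg _), ENNReal.ofReal_pow (norm_nonneg _)] at this
  simpa only [ofReal_norm, ENNReal.ofReal_ofNat] using this

/-- The estimate of a Sobolev function on `A` by its values on `A + h`. -/
theorem IsSobolev.lintegral_le_translate {M : Set (E d)} (hM : IsOpen M) {F : E d → ℝ}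
    {g : E d → E d} (hF : IsSobolev M F g) {A : Set (E d)} {h : E d}
    (hA : ∀ y ∈ A, segment ℝ y (y + h) ⊆ M) :
    ∫⁻ x in A, ‖F x‖ₑ ^ 2 ≤ 2 * (∫⁻ x in (fun y => y + h) '' A, ‖F x‖ₑ ^ 2) +
      2 * ENNReal.ofReal ‖h‖ ^ 2 * ∫⁻ x in M, ‖g x‖ₑ ^ 2 := by
  obtain ⟨h1, h2⟩ := hF.eLpNorm_translate_sub_le hM h
  have hAA : A ⊆ {y | segment ℝ y (y + h) ⊆ M} := hA
  have hmeas : AEMeasurable (fun y => 2 * ‖F (y + h)‖ₑ ^ 2) (volume.restrict A) :=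
    (((h1.aestronglyMeasurable.mono_measure (Measure.restrict_mono hAA le_rfl)).enorm).pow_const
      2).const_mul 2
  have e1 : ∫⁻ y in A, ‖F (y + h)‖ₑ ^ 2 = ∫⁻ x in (fun y => y + h) '' A, ‖F x‖ₑ ^ 2 :=
    (measurePreserving_add_right volume h).setLIntegral_comp_emb
      (measurableEmbedding_addRight h) (fun x => ‖F x‖ₑ ^ 2) A
  calc ∫⁻ x in A, ‖F x‖ₑ ^ 2
      ≤ ∫⁻ y in A, (2 * ‖F (y + h)‖ₑ ^ 2 + 2 * ‖F (y + h) - F y‖ₑ ^ 2) :=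
        lintegral_mono fun y => enorm_sq_le_two_mul _ _
    _ = 2 * (∫⁻ x in (fun y => y + h) '' A, ‖F x‖ₑ ^ 2) +
          2 * ∫⁻ y in A, ‖F (y + h) - F y‖ₑ ^ 2 := by
        rw [lintegral_add_left' hmeas, lintegral_const_mul' _ _ (by norm_num),
          lintegral_const_mul' _ _ (by norm_num), e1]
    _ ≤ _ := by
        rw [mul_assoc]
        gcongr
        calc _ ≤ ∫⁻ y in {y | segment ℝ y (y + h) ⊆ M}, ‖F (y + h) - F y‖ₑ ^ 2 :=
              lintegral_mono_set hAA
          _ ≤ _ := by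
            rw [lintegral_enorm_sq, lintegral_enorm_sq, ← mul_pow]
            gcongr

/-- The mechanism by which control spreads: it is pulled back along any vector whose segments stay
in `M`. -/
theorem Controlled.of_translate {M B : Set (E d)} (hM : IsOpen M) {A : Set (E d)} {h : E d}
    (hA : ∀ y ∈ A, segment ℝ y (y + h) ⊆ M)
    (hC : Controlled M B ((fun y => y + h) '' A)) : Controlled M B A := by
  obtain ⟨C, hC⟩ := hC
  refine ⟨2 * C + 2 * ‖h‖.toNNReal ^ 2, fun F g hF =>
    (hF.lintegral_le_translate hM hA).trans ?_⟩
  have h1 := hC F g hF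
  push_cast
  rw [add_mul, mul_assoc 2 (C : ℝ≥0∞)]
  refine add_le_add (by gcongr) ?_
  exact mul_le_mul_right le_add_self _

/-- The points of `M` that have a controlled neighbourhood. -/
def controlledPoints (M B : Set (E d)) : Set (E d) :=
  {x | x ∈ M ∧ ∃ r > 0, Controlled M B (Metric.ball x r)}

theorem isOpen_controlledPoints {M B : Set (E d)} (hM : IsOpen M) :
    IsOpen (controlledPoints M B) := by
  rw [Metric.isOpen_iff]
  rintro x ⟨hx, r, hr, hC⟩
  obtain ⟨s, hs, hsM⟩ := Metric.isOpen_iff.1 hM x hx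
  refine ⟨min r s, lt_min hr hs, fun y hy => ?_⟩
  rw [Metric.mem_ball, lt_min_iff] at hy
  exact ⟨hsM hy.2, r - dist y x, by linarith [hy.1],
    hC.mono (Metric.ball_subset_ball' (by linarith))⟩

theorem interior_inter_subset_controlledPoints {M B : Set (E d)} :
    interior B ∩ M ⊆ controlledPoints M B := by
  rintro x ⟨hx, hxM⟩
  obtain ⟨r, hr, hB⟩ := Metric.isOpen_iff.1 isOpen_interior x hx
  exact ⟨hxM, r, hr, (controlled_base M B).mono (hB.trans interior_subset)⟩

/-- Near a limit `x ∈ M` there is a controlled point `p` in the same ball of `M`. Translation by `p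
- x` takes a small ball around `x` into the controlled ball around `p`, and the segments stay in the
ball of `M` by convexity. -/
theorem closure_controlledPoints_inter_subset {M B : Set (E d)} (hM : IsOpen M) :
    closure (controlledPoints M B) ∩ M ⊆ controlledPoints M B := by
  rintro x ⟨hx, hxM⟩
  obtain ⟨ρ, hρ, hball⟩ := Metric.isOpen_iff.1 hM x hxM
  obtain ⟨p, ⟨hpM, s, hs, hC⟩, hpx⟩ := Metric.mem_closure_iff.1 hx ρ hρ
  rw [dist_comm] at hpx
  set r := min s (ρ - dist p x)
  have hr : 0 < r := lt_min hs (by linarith)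
  refine ⟨hxM, r, hr, Controlled.of_translate hM (h := p - x) ?_ (hC.mono ?_)⟩
  · intro y hy
    rw [Metric.mem_ball] at hy
    refine ((convex_ball x ρ).segment_subset ?_ ?_).trans hball
    · rw [Metric.mem_ball]
      have : r ≤ ρ - dist p x := min_le_right _ _
      linarith [dist_nonneg (x := p) (y := x)]
    · rw [Metric.mem_ball, dist_eq_norm]
      have h1 : y + (p - x) - x = (y - x) + (p - x) := by abel
      rw [h1]
      have h2 := norm_add_le (y - x) (p - x)
      rw [← dist_eq_norm, ← dist_eq_norm] at h2
      have : r ≤ ρ - dist p x := min_le_right _ _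
      linarith
  · rintro _ ⟨y, hy, rfl⟩
    rw [Metric.mem_ball, dist_eq_norm] at hy ⊢
    have h1 : y + (p - x) - p = y - x := by abel
    rw [h1]
    exact hy.trans_le (min_le_left _ _)

/-- The controlled points are open and relatively closed in `M`; this replaces a chain of balls. -/
theorem IsPreconnected.subset_controlledPoints {M B G : Set (E d)} (hM : IsOpen M)
    (hG : IsPreconnected G) (hGM : G ⊆ M) (hne : (G ∩ controlledPoints M B).Nonempty) :
    G ⊆ controlledPoints M B :=
  hG.subset_of_closure_inter_subset (isOpen_controlledPoints hM) hne
    ((inter_subset_inter_right _ hGM).trans (closure_controlledPoints_inter_subset hM))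

/-- The piecewise regularity condition propagates the control to boundary points. -/
theorem PiecewiseRegularAt.controlled {M B G : Set (E d)} (hM : IsOpen M) (hGM : G ⊆ M)
    (hG : G ⊆ controlledPoints M B) {x : E d} (hx : PiecewiseRegularAt G x) :
    ∃ U ∈ 𝓝 x, Controlled M B (U ∩ G) := by
  obtain ⟨H, hH, hev⟩ := hx
  -- The radius `1` for `h ∉ H` is a dummy value that makes the choice function total.
  have hr : ∀ h : E d, ∃ r > 0, h ∈ H → Controlled M B (Metric.ball (x + h) r) := by
    intro h
    by_cases hh : h ∈ H
    · obtain ⟨_, r, hr, hC⟩ := hG (hH h hh)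
      exact ⟨r, hr, fun _ => hC⟩
    · exact ⟨1, one_pos, fun h' => absurd h' hh⟩
  choose r hr hC using hr
  rw [eventually_nhdsWithin_iff] at hev
  have hball : ∀ᶠ y in 𝓝 x, ∀ h ∈ H, y ∈ Metric.ball x (r h) :=
    (Filter.eventually_all_finset H).2 fun h _ => Metric.ball_mem_nhds x (hr h)
  -- The neighbourhood is split according to which `h ∈ H` works; each piece is translated into the
  -- controlled ball around the point `x + h` of `G`.
  refine ⟨_, hev.and hball, Controlled.mono (A := ⋃ h ∈ H,
    {y | y ∈ Metric.ball x (r h) ∧ segment ℝ y (y + h) ⊆ M}) ?_ ?_⟩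
  · refine controlled_biUnion H fun h hh => ?_
    refine Controlled.of_translate hM (h := h) (fun y hy => hy.2) ((hC h hh).mono ?_)
    rintro _ ⟨y, ⟨hy, _⟩, rfl⟩
    simpa using hy
  · rintro y ⟨⟨h1, h2⟩, hyG⟩
    obtain ⟨h, hh, hseg⟩ := h1 hyG
    simp only [mem_iUnion]
    exact ⟨h, hh, h2 h hh, hseg.trans hGM⟩

/-- Finitely many neighbourhoods cover the compact closure, and control is stable under finite
unions. -/
theorem controlled_of_locally {M B A : Set (E d)} (hA : Bornology.IsBounded A)
    (h : ∀ x ∈ closure A, ∃ U ∈ 𝓝 x, Controlled M B (U ∩ A)) : Controlled M B A := by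
  have key : Controlled M B (closure A ∩ A) := by
    refine hA.isCompact_closure.induction_on (p := fun s => Controlled M B (s ∩ A)) ?_ ?_ ?_ ?_
    · simpa using controlled_empty M B
    · exact fun s t hst ht => ht.mono (inter_subset_inter_left _ hst)
    · intro s t hs ht
      rw [union_inter_distrib_right]
      exact hs.union ht
    · intro x hx
      obtain ⟨U, hU, hC⟩ := h x hx
      exact ⟨U, mem_nhdsWithin_of_mem_nhds hU, hC⟩
  exact key.mono (subset_inter subset_closure le_rfl)

theorem controlled_nhds_of_mem {M B A : Set (E d)} {x : E d} (hx : x ∈ controlledPoints M B) :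
    ∃ U ∈ 𝓝 x, Controlled M B (U ∩ A) := by
  obtain ⟨_, r, hr, hC⟩ := hx
  exact ⟨_, Metric.ball_mem_nhds x hr, hC.mono inter_subset_left⟩

/-! ### Extension by zero across the exterior boundary -/

theorem exists_contDiff_eq_one_near {K G : Set (E d)} (hK : IsCompact K) (hG : IsOpen G)
    (hKG : K ⊆ G) : ∃ χ : E d → ℝ, ContDiff ℝ ∞ χ ∧ HasCompactSupport χ ∧ tsupport χ ⊆ G ∧
      ∀ x ∈ K, χ =ᶠ[𝓝 x] 1 := by
  obtain ⟨K', hK', h1, h2⟩ := exists_compact_between hK hG hKG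
  obtain ⟨f, hf1, hf0, _⟩ := exists_contMDiffMap_one_nhds_of_subset_interior
    (n := (⊤ : ℕ∞)) (modelWithCornersSelf ℝ (E d)) hK.isClosed h1
  have hs : tsupport (f : E d → ℝ) ⊆ K' := closure_minimal
    (fun x hx => by_contra fun h => hx (hf0 x h)) hK'.isClosed
  refine ⟨f, f.contMDiff.contDiff, HasCompactSupport.of_support_subset_isCompact hK'
    (subset_closure.trans hs), hs.trans h2, fun x hx => ?_⟩
  exact (eventually_nhdsSet_iff_forall.1 hf1) x hx

/-- The weak gradient vanishes where the function does. -/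
theorem weakGradient_ae_eq_zero {G U : Set (E d)} (hG : IsOpen G) (hU : IsOpen U)
    {f : E d → ℝ} {g : E d → E d} (hfg : IsSobolev G f g)
    (h0 : ∀ᵐ x ∂(volume.restrict G), x ∈ U → f x = 0) :
    ∀ᵐ x ∂(volume.restrict G), x ∈ U → g x = 0 := by
  have key : ∀ j, ∀ᵐ x ∂(volume.restrict G), x ∈ G ∩ U → g x j = 0 := by
    intro j
    have hm : MemLp (fun x => g x j) 2 (volume.restrict G) :=
      (EuclideanSpace.proj j : E d →L[ℝ] ℝ).comp_memLp' hfg.memLp_grad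
    refine (hG.inter hU).ae_eq_zero_of_integral_contDiff_smul_eq_zero
      ((hm.locallyIntegrable (by norm_num)).locallyIntegrableOn _) ?_
    intro η h1 h2 h3
    have h4 := hfg.weak η h1 h2 (h3.trans inter_subset_left) j
    have h5 : ∫ x in G, f x * fderiv ℝ η x (EuclideanSpace.single j 1) = 0 := by
      refine integral_eq_zero_of_ae ?_
      filter_upwards [h0] with x hx
      by_cases hxU : x ∈ U
      · simp [hx hxU]
      · have : fderiv ℝ η x = 0 := by
          by_contra hne
          exact hxU (h3 (support_fderiv_subset ℝ hne)).2
        simp [this]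
    rw [h5] at h4
    simp only [smul_eq_mul]
    simp_rw [mul_comm (η _)]
    linarith
  filter_upwards [ae_all_iff.2 key, ae_restrict_mem hG.measurableSet] with x hx hxG hxU
  ext j
  exact hx j ⟨hxG, hxU⟩

theorem setIntegral_indicator_mul {G M : Set (E d)} (hG : IsOpen G) (hGM : G ⊆ M)
    (f ψ : E d → ℝ) : ∫ x in M, G.indicator f x * ψ x = ∫ x in G, f x * ψ x := by
  have e : ∀ x, G.indicator f x * ψ x = G.indicator (fun x => f x * ψ x) x := fun x =>
    (indicator_mul_left G f ψ).symm
  simp_rw [e]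
  rw [integral_indicator hG.measurableSet, Measure.restrict_restrict_of_subset hGM]

/-- A function on `Ω ∩ M` that vanishes near `∂Ω` may be extended by zero to `M`. -/
theorem IsSobolev.extend_by_zero {Ω M : Set (E d)} (hΩ : IsOpen Ω) (hM : IsOpen M)
    {f : E d → ℝ} {g : E d → E d} (hfg : IsSobolev (Ω ∩ M) f g)
    {U : Set (E d)} (hU : IsOpen U) (hΩU : frontier Ω ⊆ U)
    (h0 : ∀ᵐ x ∂(volume.restrict (Ω ∩ M)), x ∈ U → f x = 0) :
    IsSobolev M ((Ω ∩ M).indicator f) ((Ω ∩ M).indicator g) := by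
  have hG : IsOpen (Ω ∩ M) := hΩ.inter hM
  have hGM : Ω ∩ M ⊆ M := inter_subset_right
  have hg0 := weakGradient_ae_eq_zero hG hU hfg h0
  refine ⟨?_, ?_, ?_⟩
  · rw [memLp_indicator_iff_restrict hG.measurableSet, Measure.restrict_restrict_of_subset hGM]
    exact hfg.memLp
  · rw [memLp_indicator_iff_restrict hG.measurableSet, Measure.restrict_restrict_of_subset hGM]
    exact hfg.memLp_grad
  intro φ h1 h2 h3 j
  -- The part of the support of `φ` where the function need not vanish: it stays away from `∂Ω`,
  -- hence is compact inside `Ω ∩ M`.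
  have hK : IsCompact ((tsupport φ ∩ closure Ω) \ U) :=
    (h2.isCompact.inter_right isClosed_closure).diff hU
  have hKG : (tsupport φ ∩ closure Ω) \ U ⊆ Ω ∩ M := by
    rintro x ⟨⟨hx1, hx2⟩, hx3⟩
    refine ⟨by_contra fun hx => hx3 (hΩU ?_), h3 hx1⟩
    rw [hΩ.frontier_eq]
    exact ⟨hx2, hx⟩
  -- The cut-off `χφ` is an admissible test function in `Ω ∩ M`. It agrees with `φ` near points of
  -- `Ω ∩ M` off `U`, while on `U` both the function and its gradient vanish almost everywhere.
  obtain ⟨χ, c1, c2, c3, c4⟩ := exists_contDiff_eq_one_near hK hG hKG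
  set ψ : E d → ℝ := fun x => χ x * φ x
  have p1 : ContDiff ℝ ∞ ψ := c1.mul h1
  have p2 : HasCompactSupport ψ := c2.mul_right
  have p3 : tsupport ψ ⊆ Ω ∩ M := (tsupport_mul_subset_left).trans c3
  have hev : ∀ x ∈ Ω ∩ M, x ∉ U → ψ =ᶠ[𝓝 x] φ := by
    intro x hx hxU
    by_cases hxφ : x ∈ tsupport φ
    · filter_upwards [c4 x ⟨⟨hxφ, subset_closure hx.1⟩, hxU⟩] with y hy
      simp [ψ, hy]
    · filter_upwards [(isClosed_tsupport φ).isOpen_compl.mem_nhds hxφ] with y hy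
      simp [ψ, image_eq_zero_of_notMem_tsupport hy]
  have key := hfg.weak ψ p1 p2 p3 j
  rw [setIntegral_indicator_mul hG hGM]
  have e2 : ∀ x, (Ω ∩ M).indicator g x j = (Ω ∩ M).indicator (fun x => g x j) x := by
    intro x
    by_cases hx : x ∈ Ω ∩ M
    · rw [indicator_of_mem hx, indicator_of_mem hx]
    · rw [indicator_of_notMem hx, indicator_of_notMem hx]; rfl
  simp_rw [e2]
  rw [setIntegral_indicator_mul hG hGM]
  calc _ = ∫ x in Ω ∩ M, f x * fderiv ℝ ψ x (EuclideanSpace.single j 1) := by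
        refine integral_congr_ae ?_
        filter_upwards [h0, ae_restrict_mem hG.measurableSet] with x hx hxG
        by_cases hxU : x ∈ U
        · rw [hx hxU, zero_mul, zero_mul]
        · rw [(hev x hxG hxU).fderiv_eq]
    _ = _ := by
        rw [key]
        congr 1
        refine integral_congr_ae ?_
        filter_upwards [hg0, ae_restrict_mem hG.measurableSet] with x hx hxG
        by_cases hxU : x ∈ U
        · simp [hx hxU]
        · rw [(hev x hxG hxU).self_of_nhds]

/-! ### Geometry of the perforated domain -/

/-- The affine map that takes `Y` to the cell with index `k` at scale `ε`. -/
def cellMap (ε : ℝ) (k : Fin d → ℤ) (y : E d) : E d :=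
  ε • (y + WithLp.toLp 2 (fun j => (k j : ℝ)))

theorem isOpenMap_cellMap {ε : ℝ} (hε : ε ≠ 0) (k : Fin d → ℤ) :
    IsOpenMap (cellMap (d := d) ε k) :=
  ((Homeomorph.addRight _).trans (Homeomorph.smulOfNeZero ε hε)).isOpenMap

theorem isOpen_skeleton {Ω Y₀ : Set (E d)} (hY₀ : IsOpen Y₀) {ε : ℝ} (hε : 0 < ε) :
    IsOpen (skeleton Ω Y₀ ε) :=
  isOpen_biUnion fun k _ => isOpenMap_cellMap hε.ne' k _ hY₀

theorem skeleton_subset {Ω Y₀ : Set (E d)} {ε : ℝ} : skeleton Ω Y₀ ε ⊆ Ω :=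
  iUnion₂_subset fun _ hk => hk

theorem poreSpace_eq_inter (Ω Y₀ : Set (E d)) (ε : ℝ) :
    poreSpace Ω Y₀ ε = Ω ∩ (closure (skeleton Ω Y₀ ε))ᶜ := rfl

theorem isOpen_poreSpace {Ω Y₀ : Set (E d)} (hΩ : IsOpen Ω) (ε : ℝ) :
    IsOpen (poreSpace Ω Y₀ ε) :=
  hΩ.inter isClosed_closure.isOpen_compl

/-- Since `∂Ω = Γ^ext` is disjoint from `Γ^ε`, a point of `∂Ω` in the closed skeleton would lie in
the open skeleton, hence in the open set `Ω`. -/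
theorem AdmissibleScale.frontier_subset {Ω Y₀ : Set (E d)} (hΩ : IsOpen Ω) (hY₀ : IsOpen Y₀)
    {ε : ℝ} (h : AdmissibleScale Ω Y₀ ε) : frontier Ω ⊆ (closure (skeleton Ω Y₀ ε))ᶜ := by
  intro x hx hxc
  have h1 : x ∉ poreSurface Ω Y₀ ε := by
    rw [← h.ext_eq] at hx
    exact hx.2
  rw [poreSurface, (isOpen_skeleton hY₀ h.pos).frontier_eq] at h1
  rw [hΩ.frontier_eq] at hx
  exact hx.2 (skeleton_subset (by_contra fun h2 => h1 ⟨hxc, h2⟩))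

/-! ### From estimates of Sobolev functions to Poincaré constants -/

theorem norm_sq_eq_toReal_lintegral {H : Type*} [NormedAddCommGroup H] {μ : Measure (E d)}
    (f : Lp H 2 μ) : ‖f‖ ^ 2 = (∫⁻ x, ‖f x‖ₑ ^ 2 ∂μ).toReal := by
  rw [lintegral_enorm_sq, Lp.norm_def, ENNReal.toReal_pow]

theorem integral_norm_sq_eq {H : Type*} [NormedAddCommGroup H] [InnerProductSpace ℝ H]
    {μ : Measure (E d)} (f : Lp H 2 μ) : ∫ x, ‖f x‖ ^ 2 ∂μ = ‖f‖ ^ 2 := by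
  rw [← real_inner_self_eq_norm_sq, L2.inner_def]
  simp_rw [real_inner_self_eq_norm_sq]

/-- The inequality is a closed condition on the pair of function and gradient, so it passes to the
closure that defines `V^ε`. -/
theorem isPoincareConstant_of_vanishingNear {Ω Y₀ : Set (E d)} {ε C : ℝ} (hC : 0 < C)
    (h : ∀ p ∈ H1VanishingNear (poreSpace Ω Y₀ ε) (extBoundary Ω Y₀ ε),
      ‖p.1‖ ^ 2 ≤ C * ‖p.2‖ ^ 2) : IsPoincareConstant Ω Y₀ ε C := by
  refine ⟨hC, fun v => ?_⟩
  have hcl : IsClosed {p : L2Pair (poreSpace Ω Y₀ ε) | ‖p.1‖ ^ 2 ≤ C * ‖p.2‖ ^ 2} :=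
    isClosed_le (by fun_prop) (by fun_prop)
  have hv : ‖v.1.1‖ ^ 2 ≤ C * ‖v.1.2‖ ^ 2 :=
    closure_minimal (fun p hp => h p hp) hcl v.2.2
  rw [← integral_norm_sq_eq, ← integral_norm_sq_eq] at hv
  simpa [val, grad] using hv

/-- Extension by zero reduces the problem to Sobolev functions on the complement of the closed
skeleton, a set that continues beyond `Ω`; this is what allows translations across `∂Ω`. -/
theorem isPoincareConstant_of_sobolev {Ω Y₀ : Set (E d)} (hΩ : IsOpen Ω)
    {ε : ℝ} (hε : AdmissibleScale Ω Y₀ ε) {C : ℝ≥0} (hC : 0 < C)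
    (h : ∀ F g, IsSobolev (closure (skeleton Ω Y₀ ε))ᶜ F g → (∀ x ∉ Ω, F x = 0) →
      ∫⁻ x in poreSpace Ω Y₀ ε, ‖F x‖ₑ ^ 2 ≤
        C * ∫⁻ x in (closure (skeleton Ω Y₀ ε))ᶜ, ‖g x‖ₑ ^ 2) :
    IsPoincareConstant Ω Y₀ ε C := by
  have hM : IsOpen (closure (skeleton Ω Y₀ ε))ᶜ := isClosed_closure.isOpen_compl
  have hG := isOpen_poreSpace (Y₀ := Y₀) hΩ ε
  refine isPoincareConstant_of_vanishingNear (by exact_mod_cast hC) ?_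
  rintro p ⟨hp, U, hU, hSU, h0⟩
  rw [hε.ext_eq] at hSU
  have hS : IsSobolev (poreSpace Ω Y₀ ε) p.1 p.2 := ⟨Lp.memLp _, Lp.memLp _, hp⟩
  have key := h _ _ (IsSobolev.extend_by_zero hΩ hM hS hU hSU h0)
    (fun x hx => indicator_of_notMem (fun h' => hx h'.1) _)
  rw [← poreSpace_eq_inter] at key
  have e1 : ∫⁻ x in poreSpace Ω Y₀ ε, ‖(poreSpace Ω Y₀ ε).indicator p.1 x‖ₑ ^ 2 =
      ∫⁻ x in poreSpace Ω Y₀ ε, ‖p.1 x‖ₑ ^ 2 := by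
    refine setLIntegral_congr_fun hG.measurableSet fun x hx => ?_
    simp only [indicator_of_mem hx]
  have e2 : ∫⁻ x in (closure (skeleton Ω Y₀ ε))ᶜ, ‖(poreSpace Ω Y₀ ε).indicator p.2 x‖ₑ ^ 2 =
      ∫⁻ x in poreSpace Ω Y₀ ε, ‖p.2 x‖ₑ ^ 2 := by
    have : ∀ x, ‖(poreSpace Ω Y₀ ε).indicator p.2 x‖ₑ ^ 2 =
        (poreSpace Ω Y₀ ε).indicator (fun x => ‖p.2 x‖ₑ ^ 2) x := by
      intro x
      by_cases hx : x ∈ poreSpace Ω Y₀ ε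
      · simp only [indicator_of_mem hx]
      · simp only [indicator_of_notMem hx]; simp
    simp_rw [this]
    rw [lintegral_indicator hG.measurableSet, Measure.restrict_restrict_of_subset
      (show poreSpace Ω Y₀ ε ⊆ (closure (skeleton Ω Y₀ ε))ᶜ from inter_subset_right)]
  rw [e1, e2] at key
  have hfin : ∫⁻ x in poreSpace Ω Y₀ ε, ‖p.2 x‖ₑ ^ 2 ≠ ⊤ := by
    rw [lintegral_enorm_sq]
    exact ENNReal.pow_ne_top (Lp.memLp _).eLpNorm_ne_top
  rw [norm_sq_eq_toReal_lintegral, norm_sq_eq_toReal_lintegral]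
  have := ENNReal.toReal_mono (ENNReal.mul_ne_top ENNReal.coe_ne_top hfin) key
  rwa [ENNReal.toReal_mul, ENNReal.coe_toReal] at this

/-! ### The Poincaré inequality at a fixed scale -/

/-- The frontier of the closure is used because `∂Ω` may contain slits: only at points of this
smaller frontier is the open exterior of `Ω` guaranteed to be near. -/
theorem exists_mem_frontier_closure {Ω : Set (E d)} (hd : 0 < d) (hne : Ω.Nonempty)
    (hb : Bornology.IsBounded Ω) : (frontier (closure Ω)).Nonempty := by
  rw [nonempty_frontier_iff]
  refine ⟨hne.closure, fun h => ?_⟩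
  have : Nonempty (Fin d) := ⟨⟨0, hd⟩⟩
  have h1 := hb.closure
  rw [h] at h1
  exact NormedSpace.unbounded_univ ℝ (E d) h1

/-- A point of the frontier of `closure Ω` is a limit of exterior points, which are controlled
trivially, so it is controlled, and so are nearby points of the pore space. Connectedness does the
rest inside `M`; the remaining points of the closure lie on `Γ^ε`, where regularity applies. -/
theorem controlled_poreSpace {Ω Y₀ : Set (E d)} (hd : 0 < d) (hΩ : IsOpen Ω)
    (hΩb : Bornology.IsBounded Ω) (hY₀ : IsOpen Y₀) {ε : ℝ} (hε : AdmissibleScale Ω Y₀ ε) :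
    Controlled (closure (skeleton Ω Y₀ ε))ᶜ Ωᶜ (poreSpace Ω Y₀ ε) := by
  set M : Set (E d) := (closure (skeleton Ω Y₀ ε))ᶜ
  have hM : IsOpen M := isClosed_closure.isOpen_compl
  have hGM : poreSpace Ω Y₀ ε ⊆ M := inter_subset_right
  have hfr := hε.frontier_subset hΩ hY₀
  have hΩne : Ω.Nonempty := hε.connected.nonempty.mono inter_subset_left
  have hsub : poreSpace Ω Y₀ ε ⊆ controlledPoints M Ωᶜ := by
    refine IsPreconnected.subset_controlledPoints hM hε.connected.isPreconnected hGM ?_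
    obtain ⟨x, hx⟩ := exists_mem_frontier_closure hd hΩne hΩb
    rw [frontier_eq_closure_inter_closure, closure_closure] at hx
    have hxM : x ∈ M := by
      refine hfr ?_
      rw [frontier_eq_closure_inter_closure]
      exact ⟨hx.1, closure_mono (compl_subset_compl.2 subset_closure) hx.2⟩
    have hxP : x ∈ controlledPoints M Ωᶜ := by
      refine closure_controlledPoints_inter_subset hM ⟨?_, hxM⟩
      refine closure_mono ?_ (hM.inter_closure ⟨hxM, hx.2⟩)
      rintro y ⟨hyM, hy⟩
      exact interior_inter_subset_controlledPoints ⟨by rwa [interior_compl], hyM⟩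
    obtain ⟨y, hy, hyΩ⟩ := mem_closure_iff.1 hx.1 _ (isOpen_controlledPoints hM) hxP
    exact ⟨y, ⟨hyΩ, hy.1⟩, hy⟩
  refine controlled_of_locally (hΩb.subset inter_subset_left) fun x hx => ?_
  by_cases hxM : x ∈ M
  · exact controlled_nhds_of_mem
      (closure_controlledPoints_inter_subset hM ⟨closure_mono hsub hx, hxM⟩)
  · refine (hε.regular x ?_).controlled hM hGM hsub
    rw [poreSurface, (isOpen_skeleton hY₀ hε.pos).frontier_eq]
    refine ⟨not_not.1 hxM, fun hxS => ?_⟩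
    obtain ⟨y, hy, hyG⟩ := mem_closure_iff.1 hx _ (isOpen_skeleton hY₀ hε.pos) hxS
    exact hyG.2 (subset_closure hy)

theorem lintegral_compl_eq_zero {Ω : Set (E d)} (hΩ : IsOpen Ω) {F : E d → ℝ}
    (hF : ∀ x ∉ Ω, F x = 0) : ∫⁻ x in Ωᶜ, ‖F x‖ₑ ^ 2 = 0 := by
  rw [setLIntegral_congr_fun (g := fun _ => 0) hΩ.measurableSet.compl
    (fun x hx => by simp [hF x hx])]
  simp

theorem AdmissibleScale.exists_isPoincareConstant {Ω Y₀ : Set (E d)} (hd : 0 < d)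
    (hΩ : IsOpen Ω) (hΩb : Bornology.IsBounded Ω) (hY₀ : IsOpen Y₀) {ε : ℝ}
    (hε : AdmissibleScale Ω Y₀ ε) : ∃ C, IsPoincareConstant Ω Y₀ ε C := by
  obtain ⟨C, hC⟩ := controlled_poreSpace hd hΩ hΩb hY₀ hε
  refine ⟨_, isPoincareConstant_of_sobolev hΩ hε (C := C + 1) (by positivity)
    fun F g hF h0 => (hC F g hF).trans ?_⟩
  rw [lintegral_compl_eq_zero hΩ h0, zero_add]
  gcongr
  simp

/-! ### Restriction and rescaling of Sobolev functions -/

theorem IsSobolev.mono {M N : Set (E d)} (hM : IsOpen M) (hNM : N ⊆ M) {F : E d → ℝ}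
    {g : E d → E d} (hF : IsSobolev M F g) : IsSobolev N F g := by
  refine ⟨hF.memLp.mono_measure (Measure.restrict_mono hNM le_rfl),
    hF.memLp_grad.mono_measure (Measure.restrict_mono hNM le_rfl), fun φ h1 h2 h3 j => ?_⟩
  have h := hF.weak φ h1 h2 (h3.trans hNM) j
  rw [setIntegral_eq_of_subset_of_forall_sdiff_eq_zero hM.measurableSet hNM,
    setIntegral_eq_of_subset_of_forall_sdiff_eq_zero hM.measurableSet hNM] at h
  · exact h
  · rintro x ⟨_, hx⟩
    rw [image_eq_zero_of_notMem_tsupport fun h' => hx (h3 h'), mul_zero]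
  · rintro x ⟨_, hx⟩
    have : fderiv ℝ φ x = 0 := by
      by_contra hne
      exact hx (h3 (support_fderiv_subset ℝ hne))
    simp [this]

/-- The map `cellMap` as a homeomorphism. -/
def cellHomeo {ε : ℝ} (hε : ε ≠ 0) (k : Fin d → ℤ) : E d ≃ₜ E d :=
  (Homeomorph.addRight (WithLp.toLp 2 (fun j => (k j : ℝ)))).trans
    (Homeomorph.smulOfNeZero ε hε)

theorem coe_cellHomeo {ε : ℝ} (hε : ε ≠ 0) (k : Fin d → ℤ) :
    ⇑(cellHomeo (d := d) hε k) = cellMap ε k := rfl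

theorem cellMap_apply (ε : ℝ) (k : Fin d → ℤ) (y : E d) (j : Fin d) :
    cellMap ε k y j = ε * (y j + k j) := by
  simp [cellMap, mul_add]

/-- The factor by which `cellMap` pushes Lebesgue measure forward. -/
def cellFactor (d : ℕ) (ε : ℝ) : ℝ≥0∞ :=
  ENNReal.ofReal |(ε ^ Module.finrank ℝ (E d))⁻¹|

theorem map_cellMap_volume {ε : ℝ} (hε : ε ≠ 0) (k : Fin d → ℤ) :
    Measure.map (cellMap ε k) volume = cellFactor d ε • (volume : Measure (E d)) := by
  have h1 : cellMap (d := d) ε k =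
      (fun x => ε • x) ∘ (fun y => y + WithLp.toLp 2 (fun j => (k j : ℝ))) := rfl
  rw [h1, ← Measure.map_map (by fun_prop) (by fun_prop),
    map_add_right_eq_self, Measure.map_addHaar_smul _ hε]
  rfl

theorem cellFactor_ne_zero {ε : ℝ} (hε : ε ≠ 0) : cellFactor d ε ≠ 0 := by
  rw [cellFactor, Ne, ENNReal.ofReal_eq_zero, not_le]
  positivity

theorem map_cellMap_restrict {ε : ℝ} (hε : ε ≠ 0) (k : Fin d → ℤ) (M : Set (E d)) :
    Measure.map (cellMap ε k) (volume.restrict (cellMap ε k ⁻¹' M)) =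
      cellFactor d ε • volume.restrict M := by
  have h := (cellHomeo (d := d) hε k).measurableEmbedding.restrict_map volume M
  rw [coe_cellHomeo, map_cellMap_volume hε, Measure.restrict_smul] at h
  exact h.symm

theorem setLIntegral_comp_cellMap {ε : ℝ} (hε : ε ≠ 0) (k : Fin d → ℤ) (A : Set (E d))
    (f : E d → ℝ≥0∞) :
    ∫⁻ y in A, f (cellMap ε k y) = cellFactor d ε * ∫⁻ x in cellMap ε k '' A, f x := by
  have h := map_cellMap_restrict hε k (cellMap ε k '' A)
  rw [preimage_image_eq _ (show Function.Injective (cellMap ε k) from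
    (cellHomeo hε k).injective)] at h
  have h2 := (cellHomeo hε k).measurableEmbedding.lintegral_map (μ := volume.restrict A) f
  rw [coe_cellHomeo, h, lintegral_smul_measure] at h2
  exact h2.symm

theorem setIntegral_comp_cellMap {ε : ℝ} (hε : ε ≠ 0) (k : Fin d → ℤ) (M : Set (E d))
    (f : E d → ℝ) :
    ∫ y in cellMap ε k ⁻¹' M, f (cellMap ε k y) = (cellFactor d ε).toReal * ∫ x in M, f x := by
  have h2 := (cellHomeo hε k).measurableEmbedding.integral_map
    (μ := volume.restrict (cellMap ε k ⁻¹' M)) f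
  rw [coe_cellHomeo, map_cellMap_restrict hε, integral_smul_measure] at h2
  exact h2.symm

/-- Test functions on the cell are transported to `M` by the inverse affine map; the chain rule
produces the factor `ε` of the gradient, and the Jacobian is common to both sides. -/
theorem IsSobolev.comp_cellMap {M : Set (E d)} {F : E d → ℝ} {g : E d → E d}
    (hF : IsSobolev M F g) {ε : ℝ} (hε : ε ≠ 0) (k : Fin d → ℤ) :
    IsSobolev (cellMap ε k ⁻¹' M) (fun y => F (cellMap ε k y))
      (fun y => ε • g (cellMap ε k y)) := by
  have hme := (cellHomeo (d := d) hε k).measurableEmbedding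
  have htop : cellFactor d ε ≠ ⊤ := ENNReal.ofReal_ne_top
  have hmem : ∀ {H : Type} [NormedAddCommGroup H] (f : E d → H),
      MemLp f 2 (volume.restrict M) →
      MemLp (fun y => f (cellMap ε k y)) 2 (volume.restrict (cellMap ε k ⁻¹' M)) := by
    intro H _ f hf
    have := hf.smul_measure htop
    rw [← map_cellMap_restrict hε k] at this
    exact hme.memLp_map_measure_iff.1 this
  refine ⟨hmem F hF.memLp, (hmem g hF.memLp_grad).const_smul ε, fun φ h1 h2 h3 j => ?_⟩
  set S : E d → E d := ⇑(cellHomeo hε k).symm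
  have hST : ∀ y, S (cellMap ε k y) = y := (cellHomeo hε k).symm_apply_apply
  have hS : ∀ x, S x = ε⁻¹ • x + -WithLp.toLp 2 (fun j => (k j : ℝ)) := fun x => by
    apply (cellHomeo hε k).injective
    rw [Homeomorph.apply_symm_apply, coe_cellHomeo, cellMap, neg_add_cancel_right,
      smul_inv_smul₀ hε]
  have hSd : ContDiff ℝ ∞ S := by
    have : S = fun x => ε⁻¹ • x + -WithLp.toLp 2 (fun j => (k j : ℝ)) := funext hS
    rw [this]
    exact (contDiff_id.const_smul _).add contDiff_const
  have p1 : ContDiff ℝ ∞ (φ ∘ S) := h1.comp hSd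
  have p2 : HasCompactSupport (φ ∘ S) := h2.comp_homeomorph (cellHomeo hε k).symm
  have p3 : tsupport (φ ∘ S) ⊆ M := by
    intro x hx
    have hx' : S x ∈ tsupport φ := by
      rw [show tsupport (φ ∘ S) = S ⁻¹' tsupport φ from
        tsupport_comp_eq_preimage φ (cellHomeo hε k).symm] at hx
      exact hx
    have := h3 hx'
    rwa [mem_preimage, show cellMap ε k (S x) = x from (cellHomeo hε k).apply_symm_apply x] at this
  have hder : ∀ y, fderiv ℝ φ y (EuclideanSpace.single j 1) =
      ε * fderiv ℝ (φ ∘ S) (cellMap ε k y) (EuclideanSpace.single j 1) := by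
    intro y
    have hS' : HasFDerivAt S (ε⁻¹ • ContinuousLinearMap.id ℝ (E d)) (cellMap ε k y) := by
      have : S = fun x => ε⁻¹ • x + -WithLp.toLp 2 (fun j => (k j : ℝ)) := funext hS
      rw [this]
      exact ((hasFDerivAt_id (𝕜 := ℝ) (cellMap ε k y)).const_smul ε⁻¹).add_const _
    have hφ : HasFDerivAt φ (fderiv ℝ φ y) (S (cellMap ε k y)) := by
      rw [hST]
      exact ((h1.differentiable (by simp)) y).hasFDerivAt
    rw [(hφ.comp _ hS').fderiv]
    simp [hε]
  have key := hF.weak _ p1 p2 p3 j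
  have e1 := setIntegral_comp_cellMap hε k M
    (fun x => F x * fderiv ℝ (φ ∘ S) x (EuclideanSpace.single j 1))
  have e2 := setIntegral_comp_cellMap hε k M (fun x => g x j * (φ ∘ S) x)
  rw [key] at e1
  calc _ = ∫ y in cellMap ε k ⁻¹' M, ε * (F (cellMap ε k y) *
        fderiv ℝ (φ ∘ S) (cellMap ε k y) (EuclideanSpace.single j 1)) := by
        congr 1
        ext y
        rw [hder]
        ring
    _ = -(ε * ∫ y in cellMap ε k ⁻¹' M, g (cellMap ε k y) j * (φ ∘ S) (cellMap ε k y)) := by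
        rw [integral_const_mul, e1, e2]
        ring
    _ = _ := by
        rw [← integral_const_mul]
        congr 2
        ext y
        simp [hST]
        ring

/-! ### The cell -/

/-- The closed cube of points of the cell with distance at least `δ` to its faces. -/
def core (d : ℕ) (δ : ℝ) : Set (E d) := {y | ∀ j, δ ≤ y j ∧ y j ≤ 1 - δ}

theorem isClosed_core (δ : ℝ) : IsClosed (core d δ) := by
  simp only [core, ofPred_forall, ofPred_and]
  exact isClosed_iInter fun j => (isClosed_le (by fun_prop) (by fun_prop)).inter
    (isClosed_le (by fun_prop) (by fun_prop))

theorem isOpen_unitCell : IsOpen (unitCell d) := by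
  simp only [unitCell, ofPred_forall, ofPred_and]
  exact isOpen_iInter_of_finite fun j => (isOpen_lt (by fun_prop) (by fun_prop)).inter
    (isOpen_lt (by fun_prop) (by fun_prop))

theorem core_subset_unitCell {δ : ℝ} (hδ : 0 < δ) : core d δ ⊆ unitCell d := fun y hy j =>
  ⟨hδ.trans_le (hy j).1, by linarith [(hy j).2]⟩

theorem convex_unitCell : Convex ℝ (unitCell d) := by
  intro x hx y hy a b ha hb hab j
  have h1 := hx j
  have h2 := hy j
  have e : (a • x + b • y) j = a * x j + b * y j := by simp
  rw [e]
  have := convex_Ioo (0 : ℝ) 1 h1 h2 ha hb hab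
  simpa using this

theorem isBounded_unitCell : Bornology.IsBounded (unitCell d) := by
  refine (Metric.isBounded_iff_subset_closedBall 0).2 ⟨√d, fun y hy => ?_⟩
  rw [mem_closedBall_zero_iff, EuclideanSpace.norm_eq]
  refine Real.sqrt_le_sqrt ?_
  calc ∑ i, ‖y i‖ ^ 2 ≤ ∑ i : Fin d, (1 : ℝ) := by
        refine Finset.sum_le_sum fun i _ => ?_
        rw [Real.norm_eq_abs, sq_abs]
        nlinarith [(hy i).1, (hy i).2]
    _ = d := by simp

/-- A point closer than `δ` to a face could be moved onto that face, which is outside the open cell,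
by less than the distance that compactness allows. The bound `δ ≤ 1` keeps the point with
coordinates `δ / 2` in the cell. -/
theorem exists_subset_core {K : Set (E d)} (hK : IsCompact K) (hKY : K ⊆ unitCell d) :
    ∃ δ > 0, δ ≤ 1 ∧ K ⊆ core d δ := by
  obtain ⟨δ, hδ, h⟩ := hK.exists_thickening_subset_open isOpen_unitCell hKY
  refine ⟨min δ 1, lt_min hδ one_pos, min_le_right _ _, fun y hy j => ⟨?_, ?_⟩⟩
  · by_contra! hlt
    have hyj := (hKY hy j).1
    have : y - y j • EuclideanSpace.single j (1 : ℝ) ∈ unitCell d := by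
      refine h (Metric.mem_thickening_iff.2 ⟨y, hy, ?_⟩)
      rw [dist_eq_norm, sub_sub_cancel_left, norm_neg, norm_smul, Real.norm_eq_abs,
        abs_of_pos hyj]
      simpa using hlt.trans_le (min_le_left _ _)
    have := (this j).1
    simp at this
  · by_contra! hlt
    have hyj := (hKY hy j).2
    have : y + (1 - y j) • EuclideanSpace.single j (1 : ℝ) ∈ unitCell d := by
      refine h (Metric.mem_thickening_iff.2 ⟨y, hy, ?_⟩)
      rw [dist_eq_norm, add_sub_cancel_left, norm_smul, Real.norm_eq_abs,
        abs_of_pos (by linarith)]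
      have : min δ 1 ≤ δ := min_le_left _ _
      simp
      linarith
    have := (this j).2
    simp at this

/-- Control of the cell with a perforation by the part of the cell near its faces. -/
theorem controlled_cell {Y₀ : Set (E d)} (hY₀ : IsOpen Y₀) {δ : ℝ} (hδ : 0 < δ)
    (hconn : unitCell d \ closure Y₀ ⊆
      controlledPoints (unitCell d \ closure Y₀) (unitCell d \ core d δ))
    (hreg : ∀ x ∈ frontier Y₀, PiecewiseRegularAt (unitCell d \ closure Y₀) x) :
    Controlled (unitCell d \ closure Y₀) (unitCell d \ core d δ) (unitCell d \ closure Y₀) := by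
  have hM : IsOpen (unitCell d \ closure Y₀) := isOpen_unitCell.sdiff isClosed_closure
  refine controlled_of_locally (isBounded_unitCell.subset sdiff_subset) fun x hx => ?_
  by_cases hx0 : x ∈ closure Y₀
  · refine (hreg x ?_).controlled hM le_rfl hconn
    rw [hY₀.frontier_eq]
    refine ⟨hx0, fun h => ?_⟩
    obtain ⟨y, hy, hyG⟩ := mem_closure_iff.1 hx _ hY₀ h
    exact hyG.2 (subset_closure hy)
  by_cases hxY : x ∈ unitCell d
  · exact controlled_nhds_of_mem (hconn ⟨hxY, hx0⟩)
  -- Closure points on the faces of the cube need no regularity, because near them the base set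
  -- contains all of the perforated cell.
  · have hxc : x ∉ core d δ := fun h => hxY (core_subset_unitCell hδ h)
    refine ⟨_, (isClosed_core δ).isOpen_compl.mem_nhds hxc,
      (controlled_base _ _).mono fun y hy => ⟨hy.2.1, hy.1⟩⟩

/-- A relatively clopen part of the perforated cell that contains the points near the faces of
the cell is the whole perforated cell, if the cell is part of a connected perforated domain. -/
theorem perforatedCell_subset_of_clopen {Ω G Y₀ P : Set (E d)} (hd : 0 < d) (hΩ : IsOpen Ω)
    (hΩb : Bornology.IsBounded Ω) (hG : IsPreconnected G) {δ : ℝ} (hδ : 0 < δ)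
    (hYΩ : closure Y₀ ⊆ Ω) (hGY : G ∩ unitCell d = Ω ∩ (unitCell d \ closure Y₀)) (hfr : frontier Ω ⊆ closure G)
    (hP : IsOpen P) (hPc : closure P ∩ (unitCell d \ closure Y₀) ⊆ P)
    (hPs : unitCell d \ core d δ ⊆ P) : unitCell d \ closure Y₀ ⊆ P := by
  set Ys : Set (E d) := unitCell d \ closure Y₀
  have hYs : IsOpen Ys := isOpen_unitCell.sdiff isClosed_closure
  -- A nonempty `Q` would be enclosed by the perforation: it is clopen in the perforated cell and
  -- does not come near the faces, so its frontier lies in `closure Y₀`.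
  set Q : Set (E d) := Ys \ P
  have hQo : IsOpen Q := by
    have : Q = Ys \ closure P := by
      ext x
      exact ⟨fun h => ⟨h.1, fun h' => h.2 (hPc ⟨h', h.1⟩)⟩,
        fun h => ⟨h.1, fun h' => h.2 (subset_closure h')⟩⟩
    rw [this]
    exact hYs.sdiff isClosed_closure
  have hQcl : closure Q ∩ Ys ⊆ Q := by
    rintro x ⟨hx, hxY⟩
    refine ⟨hxY, fun hxP => ?_⟩
    obtain ⟨y, hy, hyQ⟩ := mem_closure_iff.1 hx _ hP hxP
    exact hyQ.2 hy
  have hQcore : closure Q ⊆ core d δ :=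
    closure_minimal (fun x hx => by_contra fun h => hx.2 (hPs ⟨hx.1.1, h⟩)) (isClosed_core δ)
  have hQY : closure Q ⊆ unitCell d := hQcore.trans (core_subset_unitCell hδ)
  have hQcases : ∀ x ∈ closure Q, x ∈ Q ∨ x ∈ closure Y₀ := by
    intro x hx
    by_cases h : x ∈ closure Y₀
    · exact Or.inr h
    · exact Or.inl (hQcl ⟨hx, hQY hx, h⟩)
  have hQb : Bornology.IsBounded Q :=
    isBounded_unitCell.subset (sdiff_subset.trans sdiff_subset)
  have hne : Nonempty (Fin d) := ⟨⟨0, hd⟩⟩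
  have hunb := NormedSpace.unbounded_univ ℝ (E d)
  by_contra hnot
  have hQne : Q.Nonempty := by
    obtain ⟨x, hx, hxP⟩ := not_subset.1 hnot
    exact ⟨x, hx, hxP⟩
  -- At a frontier point of `Q`, which lies in `closure Y₀ ⊆ Ω`, the sets `Q` and `Ω` meet, hence
  -- `Q` meets `G`; being connected, `G` is trapped in `Q`.
  have hGQ : G ⊆ Q := by
    refine hG.subset_of_closure_inter_subset hQo ?_ ?_
    · obtain ⟨x, hx⟩ : (frontier Q).Nonempty := by
        rw [nonempty_frontier_iff]
        exact ⟨hQne, fun h => hunb (h ▸ hQb)⟩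
      rw [hQo.frontier_eq] at hx
      have hxY : x ∈ closure Y₀ := (hQcases x hx.1).resolve_left hx.2
      obtain ⟨y, hyΩ, hyQ⟩ := mem_closure_iff.1 hx.1 _ hΩ (hYΩ hxY)
      have : y ∈ G ∩ unitCell d := by
        rw [hGY]
        exact ⟨hyΩ, hyQ.1⟩
      exact ⟨y, this.1, hyQ⟩
    · rintro z ⟨hz, hzG⟩
      have : z ∈ Ω ∩ Ys := by
        rw [← hGY]
        exact ⟨hzG, hQY hz⟩
      exact hQcl ⟨hz, this.2⟩
  have hfrQ : frontier Ω ⊆ Q := by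
    intro x hx
    refine (hQcases x (closure_mono hGQ (hfr hx))).resolve_right fun h => ?_
    rw [hΩ.frontier_eq] at hx
    exact hx.2 (hYΩ h)
  -- As `∂Ω` is trapped in `Q` as well, `Ω ∪ Q` would be a bounded nonempty clopen subset of `ℝ^d`.
  have hclopen : IsClopen (Ω ∪ Q) := by
    refine ⟨?_, hΩ.union hQo⟩
    refine isClosed_of_closure_subset ?_
    rw [closure_union]
    rintro x (hx | hx)
    · by_cases hxΩ : x ∈ Ω
      · exact Or.inl hxΩ
      · exact Or.inr (hfrQ (by rw [hΩ.frontier_eq]; exact ⟨hx, hxΩ⟩))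
    · exact (hQcases x hx).elim Or.inr fun h => Or.inl (hYΩ h)
  rcases isClopen_iff.1 hclopen with h | h
  · exact (hQne.mono subset_union_right).ne_empty h
  · exact hunb (h ▸ hΩb.union hQb)

/-- The regularity of the boundary of a perforation inside a domain implies the regularity
of its boundary inside the cell. -/
theorem PiecewiseRegularAt.perforatedCell {Ω G Y₀ : Set (E d)} (hΩ : IsOpen Ω)
    {δ : ℝ} (hδ : 0 < δ) (hcore : closure Y₀ ⊆ core d δ)
    (hGY : G ∩ unitCell d = Ω ∩ (unitCell d \ closure Y₀)) {x : E d} (hx : x ∈ closure Y₀)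
    (hxΩ : x ∈ Ω) (hreg : PiecewiseRegularAt G x) :
    PiecewiseRegularAt (unitCell d \ closure Y₀) x := by
  classical
  obtain ⟨H, hH, hev⟩ := hreg
  have hxY : x ∈ unitCell d := core_subset_unitCell hδ (hcore hx)
  have hGY' : G ∩ unitCell d ⊆ unitCell d \ closure Y₀ := hGY.le.trans inter_subset_right
  -- The vector `h` may leave the cell and has to be shortened. If it does leave, the segment from
  -- `x` in the core to the outside is connected, so it crosses the shell between core and faces,
  -- which is free of `closure Y₀`. The value `t = 0` for `h ∉ H` is a dummy.
  have ht : ∀ h : E d, ∃ t ∈ Icc (0 : ℝ) 1, h ∈ H → x + t • h ∈ unitCell d \ closure Y₀ := by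
    intro h
    by_cases hh : h ∈ H
    swap
    · exact ⟨0, by simp, fun h' => absurd h' hh⟩
    by_cases hc : x + h ∈ unitCell d
    · exact ⟨1, by simp, fun _ => hGY' ⟨by simpa using hH h hh, by simpa using hc⟩⟩
    · by_contra! hno
      have hcov : segment ℝ x (x + h) ⊆ core d δ ∪ (unitCell d)ᶜ := by
        intro z hz
        by_contra hz'
        rw [mem_union, not_or, notMem_compl_iff] at hz'
        rw [segment_eq_image', add_sub_cancel_left] at hz
        obtain ⟨t, ht, rfl⟩ := hz
        exact (hno t ht).2 ⟨hz'.2, fun h' => hz'.1 (hcore h')⟩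
      have hconn : IsPreconnected (segment ℝ x (x + h)) := (convex_segment _ _).isPreconnected
      obtain ⟨z, _, hz1, hz2⟩ := isPreconnected_closed_iff.1 hconn _ _ (isClosed_core δ)
        isOpen_unitCell.isClosed_compl hcov ⟨x, left_mem_segment ℝ _ _, hcore hx⟩
        ⟨x + h, right_mem_segment ℝ _ _, hc⟩
      exact hz2 (core_subset_unitCell hδ hz1)
  choose t ht1 ht2 using ht
  refine ⟨H.image fun h => t h • h, ?_, ?_⟩
  · intro h' hh'
    obtain ⟨h, hh, rfl⟩ := Finset.mem_image.1 hh'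
    exact ht2 h hh
  · rw [eventually_nhdsWithin_iff] at hev ⊢
    have h1 : ∀ᶠ y in 𝓝 x, ∀ h ∈ H, y + t h • h ∈ unitCell d := by
      refine (Filter.eventually_all_finset H).2 fun h hh => ?_
      have hc : ContinuousAt (fun y => y + t h • h) x := by fun_prop
      exact hc.preimage_mem_nhds (isOpen_unitCell.mem_nhds (ht2 h hh).1)
    filter_upwards [hev, h1, hΩ.mem_nhds hxΩ] with y hy1 hy2 hyΩ hyY
    have hyG : y ∈ G ∩ unitCell d := by
      rw [hGY]
      exact ⟨hyΩ, hyY⟩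
    obtain ⟨h, hh, hseg⟩ := hy1 hyG.1
    -- The shortened segment lies in `G` as part of the old one, and in the cell by convexity.
    refine ⟨t h • h, Finset.mem_image_of_mem _ hh, fun z hz => hGY' ⟨hseg ?_, ?_⟩⟩
    · refine (convex_segment _ _).segment_subset (left_mem_segment ℝ _ _) ?_ hz
      rw [segment_eq_image', add_sub_cancel_left]
      exact ⟨t h, ht1 h, rfl⟩
    · exact convex_unitCell.segment_subset hyY.1 (hy2 h hh) hz

theorem cellMap_add (ε : ℝ) (k : Fin d → ℤ) (y h : E d) :
    cellMap ε k (y + h) = cellMap ε k y + ε • h := by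
  simp only [cellMap, smul_add]
  abel

theorem PiecewiseRegularAt.preimage_cellMap {G : Set (E d)} {ε : ℝ} (hε : ε ≠ 0)
    (k : Fin d → ℤ) {x : E d} (h : PiecewiseRegularAt G (cellMap ε k x)) :
    PiecewiseRegularAt (cellMap ε k ⁻¹' G) x := by
  classical
  obtain ⟨H, hH, hev⟩ := h
  have hcont : Continuous (cellMap (d := d) ε k) := (cellHomeo hε k).continuous
  refine ⟨H.image fun h => ε⁻¹ • h, ?_, ?_⟩
  · intro h' hh'
    obtain ⟨h, hh, rfl⟩ := Finset.mem_image.1 hh'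
    rw [mem_preimage, cellMap_add, smul_inv_smul₀ hε]
    exact hH h hh
  · have ht : Tendsto (cellMap ε k) (𝓝[cellMap ε k ⁻¹' G] x) (𝓝[G] (cellMap ε k x)) :=
      hcont.continuousWithinAt.tendsto_nhdsWithin (mapsTo_preimage _ _)
    filter_upwards [ht.eventually hev] with y hy
    obtain ⟨h, hh, hseg⟩ := hy
    refine ⟨ε⁻¹ • h, Finset.mem_image_of_mem _ hh, fun z hz => hseg ?_⟩
    rw [segment_eq_image', add_sub_cancel_left] at hz ⊢
    obtain ⟨t, ht, rfl⟩ := hz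
    refine ⟨t, ht, ?_⟩
    simp only
    rw [cellMap_add, smul_comm t ε⁻¹ h, smul_inv_smul₀ hε]

/-- Open cells with different indices are disjoint: two integers that differ by less than one are
equal. -/
theorem cellMap_floor_unique {ε : ℝ} (hε : 0 < ε) {k l : Fin d → ℤ} {y z : E d}
    (hy : y ∈ unitCell d) (hz : z ∈ unitCell d) (h : cellMap ε k y = cellMap ε l z) : k = l := by
  funext j
  have h1 : ε * (y j + k j) = ε * (z j + l j) := by
    rw [← cellMap_apply, ← cellMap_apply, h]
  have h2 := mul_left_cancel₀ hε.ne' h1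
  have h3 : (k j : ℝ) < l j + 1 := by linarith [(hy j).1, (hz j).2]
  have h4 : (l j : ℝ) < k j + 1 := by linarith [(hy j).2, (hz j).1]
  have h5 : k j < l j + 1 := by exact_mod_cast h3
  have h6 : l j < k j + 1 := by exact_mod_cast h4
  omega

/-- The closure of the skeleton in a cell is the closure of the perforation of that cell. -/
theorem unitCell_inter_preimage_closure_skeleton {Ω Y₀ : Set (E d)} (hY : Y₀ ⊆ unitCell d)
    {ε : ℝ} (hε : 0 < ε) (k : Fin d → ℤ) (Z : Set (E d)) (hZ : Z ⊆ unitCell d)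
    (h : ∀ y ∈ unitCell d, y ∈ Z ↔ y ∈ Y₀ ∧ hole Y₀ ε k ⊆ Ω) :
    unitCell d ∩ cellMap ε k ⁻¹' closure (skeleton Ω Y₀ ε) = unitCell d ∩ closure Z := by
  have h1 : cellMap ε k ⁻¹' closure (skeleton Ω Y₀ ε) =
      closure (cellMap ε k ⁻¹' skeleton Ω Y₀ ε) := (cellHomeo hε.ne' k).preimage_closure _
  -- Only the perforation with index `k` can meet the open cell `k`. Thus `Z` is `Y₀` or empty,
  -- according to whether this perforation was kept in the skeleton.
  have h2 : unitCell d ∩ cellMap ε k ⁻¹' skeleton Ω Y₀ ε = Z := by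
    ext y
    constructor
    · rintro ⟨hy, hys⟩
      obtain ⟨l, hl, z, hz, hzy⟩ := mem_iUnion₂.1 hys
      have hkl : l = k := cellMap_floor_unique hε (hY hz) hy hzy
      subst hkl
      have : z = y := (cellHomeo hε.ne' l).injective hzy
      subst this
      exact (h z hy).2 ⟨hz, hl⟩
    · intro hy
      have h3 := (h y (hZ hy)).1 hy
      exact ⟨hZ hy, mem_iUnion₂.2 ⟨k, h3.2, y, h3.1, rfl⟩⟩
  rw [h1]
  refine subset_antisymm (fun x hx => ⟨hx.1, ?_⟩) fun x hx => ⟨hx.1, ?_⟩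
  · rw [← h2] at hx
    exact closure_mono inter_subset_right hx.2
  · rw [← h2]
    exact isOpen_unitCell.inter_closure hx

theorem unitCell_inter_preimage_poreSpace {Ω Y₀ : Set (E d)} (hY : Y₀ ⊆ unitCell d)
    {ε : ℝ} (hε : 0 < ε) {k : Fin d → ℤ} (hk : hole Y₀ ε k ⊆ Ω) :
    unitCell d ∩ cellMap ε k ⁻¹' (closure (skeleton Ω Y₀ ε))ᶜ = unitCell d \ closure Y₀ := by
  have h := unitCell_inter_preimage_closure_skeleton (Ω := Ω) hY hε k Y₀ hY
    (fun y _ => by simp [hk])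
  rw [preimage_compl, ← sdiff_eq, ← sdiff_self_inter, h, sdiff_self_inter]

theorem unitCell_subset_preimage_of_not_hole {Ω Y₀ : Set (E d)} (hY : Y₀ ⊆ unitCell d)
    {ε : ℝ} (hε : 0 < ε) {k : Fin d → ℤ} (hk : ¬ hole Y₀ ε k ⊆ Ω) :
    unitCell d ∩ cellMap ε k ⁻¹' (closure (skeleton Ω Y₀ ε))ᶜ = unitCell d := by
  have h := unitCell_inter_preimage_closure_skeleton (Ω := Ω) hY hε k ∅ (empty_subset _)
    (fun y _ => by simp [hk])
  rw [preimage_compl, ← sdiff_eq, ← sdiff_self_inter, h]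
  simp

/-- The cell with a perforation that occurs in some admissible domain is controlled by its part
near the faces of the cell. -/
theorem AdmissibleScale.controlled_cell {Ω Y₀ : Set (E d)} (hd : 0 < d) (hΩ : IsOpen Ω)
    (hΩb : Bornology.IsBounded Ω) (hY₀ : IsOpen Y₀) {δ : ℝ} (hδ : 0 < δ)
    (hcore : closure Y₀ ⊆ core d δ) {ε : ℝ} (hε : AdmissibleScale Ω Y₀ ε) {k : Fin d → ℤ}
    (hk : hole Y₀ ε k ⊆ Ω) :
    Controlled (unitCell d \ closure Y₀) (unitCell d \ core d δ) (unitCell d \ closure Y₀) := by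
  have hM : IsOpen (unitCell d \ closure Y₀) := isOpen_unitCell.sdiff isClosed_closure
  have hYc : closure Y₀ ⊆ unitCell d := hcore.trans (core_subset_unitCell hδ)
  have hY : Y₀ ⊆ unitCell d := subset_closure.trans hYc
  have hε0 := hε.pos.ne'
  set T : E d → E d := cellMap ε k
  have hTc : Continuous T := (cellHomeo hε0 k).continuous
  have hYS : T '' Y₀ ⊆ skeleton Ω Y₀ ε := fun x hx => mem_iUnion₂.2 ⟨k, hk, hx⟩
  have hYclS : ∀ x ∈ closure Y₀, T x ∈ closure (skeleton Ω Y₀ ε) := fun x hx =>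
    closure_mono hYS (image_closure_subset_closure_image hTc ⟨x, hx, rfl⟩)
  -- The closed perforation cannot touch `∂Ω`, although only the open one is assumed to lie in `Ω`.
  have hYΩ : closure Y₀ ⊆ T ⁻¹' Ω := by
    intro x hx
    by_contra hxΩ
    refine hε.frontier_subset hΩ hY₀ ?_ (hYclS x hx)
    rw [hΩ.frontier_eq]
    exact ⟨closure_mono skeleton_subset (hYclS x hx), hxΩ⟩
  have hGY : T ⁻¹' poreSpace Ω Y₀ ε ∩ unitCell d = T ⁻¹' Ω ∩ (unitCell d \ closure Y₀) := by
    rw [poreSpace_eq_inter, preimage_inter, inter_assoc, inter_comm _ (unitCell d),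
      unitCell_inter_preimage_poreSpace hY hε.pos hk]
  have hfrΩ : frontier (T ⁻¹' Ω) ⊆ closure (T ⁻¹' poreSpace Ω Y₀ ε) := by
    have h1 : frontier (T ⁻¹' Ω) = T ⁻¹' frontier Ω := ((cellHomeo hε0 k).preimage_frontier Ω).symm
    have h2 : closure (T ⁻¹' poreSpace Ω Y₀ ε) = T ⁻¹' closure (poreSpace Ω Y₀ ε) :=
      ((cellHomeo hε0 k).preimage_closure _).symm
    rw [h1, h2, ← hε.ext_eq]
    exact preimage_mono (sdiff_subset.trans frontier_subset_closure)
  have hconn : IsPreconnected (T ⁻¹' poreSpace Ω Y₀ ε) :=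
    (cellHomeo hε0 k).isPreconnected_preimage.2 hε.connected.isPreconnected
  have hbdd : Bornology.IsBounded (T ⁻¹' Ω) := by
    have h1 : T ⁻¹' Ω ⊆ (cellHomeo hε0 k).symm '' closure Ω := by
      intro x hx
      exact ⟨T x, subset_closure hx, (cellHomeo hε0 k).symm_apply_apply x⟩
    exact (hΩb.isCompact_closure.image (cellHomeo hε0 k).symm.continuous).isBounded.subset h1
  refine Perforated.controlled_cell hY₀ hδ ?_ ?_
  · refine perforatedCell_subset_of_clopen hd (hΩ.preimage hTc) hbdd hconn hδ hYΩ hGY hfrΩ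
      (isOpen_controlledPoints hM) (closure_controlledPoints_inter_subset hM) ?_
    have hopen : IsOpen (unitCell d \ core d δ) := isOpen_unitCell.sdiff (isClosed_core δ)
    refine fun x hx => interior_inter_subset_controlledPoints ⟨?_, hx.1, fun h => hx.2 (hcore h)⟩
    rwa [hopen.interior_eq]
  · intro x hx
    have hx0 := frontier_subset_closure hx
    refine PiecewiseRegularAt.perforatedCell (hΩ.preimage hTc) hδ hcore hGY hx0 (hYΩ hx0) ?_
    refine PiecewiseRegularAt.preimage_cellMap hε0 k (hε.regular _ ?_)
    rw [poreSurface, (isOpen_skeleton hY₀ hε.pos).frontier_eq]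
    refine ⟨hYclS x hx0, fun hxS => ?_⟩
    obtain ⟨l, hl, z, hz, hzx⟩ := mem_iUnion₂.1 hxS
    have hkl : l = k := cellMap_floor_unique hε.pos (hY hz) (hYc hx0) hzx
    subst hkl
    have : z = x := (cellHomeo hε0 l).injective hzx
    rw [hY₀.frontier_eq] at hx
    exact hx.2 (this ▸ hz)

/-- The case of an empty perforation, needed for the cells whose perforation is left out; convexity
supplies the connectedness. -/
theorem controlled_unitCell (hd : 0 < d) {δ : ℝ} (hδ : 0 < δ) (hδ1 : δ ≤ 1) :
    Controlled (unitCell d) (unitCell d \ core d δ) (unitCell d) := by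
  have h := Perforated.controlled_cell (d := d) isOpen_empty hδ ?_ (by simp)
  · simpa using h
  have hopen : IsOpen (unitCell d \ core d δ) := isOpen_unitCell.sdiff (isClosed_core δ)
  simp only [closure_empty, sdiff_empty]
  refine IsPreconnected.subset_controlledPoints isOpen_unitCell convex_unitCell.isPreconnected
    le_rfl ⟨WithLp.toLp 2 (fun _ => δ / 2), ?_, ?_⟩
  · exact fun j => ⟨by simpa using hδ, by simp; linarith⟩
  · have hY : (WithLp.toLp 2 (fun _ => δ / 2) : E d) ∈ unitCell d :=
      fun j => ⟨by simpa using hδ, by simp; linarith⟩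
    refine interior_inter_subset_controlledPoints ⟨?_, hY⟩
    rw [hopen.interior_eq]
    refine ⟨hY, fun h => ?_⟩
    have := (h ⟨0, hd⟩).1
    simp at this
    linarith

/-! ### The uniform Poincaré inequality -/

/-- The neighbourhood of the grid planes orthogonal to the direction `j`. -/
def slab (ε δ : ℝ) (j : Fin d) : Set (E d) := {x | ∃ m : ℤ, |x j - ε * m| < ε * δ}

theorem isOpen_slab (ε δ : ℝ) (j : Fin d) : IsOpen (slab ε δ j) := by
  have : slab ε δ j = ⋃ m : ℤ, {x : E d | |x j - ε * m| < ε * δ} := by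
    ext x
    simp [slab]
  rw [this]
  exact isOpen_iUnion fun m => isOpen_lt (by fun_prop) (by fun_prop)

/-- In the coordinate `j` each perforation keeps distance at least `εδ` from every grid plane. Since
the slab is open, avoiding the skeleton implies avoiding its closure. -/
theorem slab_subset_compl_closure_skeleton {Ω Y₀ : Set (E d)} {ε δ : ℝ} (hε : 0 < ε)
    (hY : Y₀ ⊆ core d δ) (j : Fin d) : slab ε δ j ⊆ (closure (skeleton Ω Y₀ ε))ᶜ := by
  rw [subset_compl_iff_disjoint_right]
  refine Disjoint.closure_right ?_ (isOpen_slab ε δ j)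
  rw [Set.disjoint_left]
  rintro x ⟨m, hm⟩ hx
  obtain ⟨k, _, y, hy, rfl⟩ := mem_iUnion₂.1 hx
  have e : (ε • (y + WithLp.toLp 2 (fun j => (k j : ℝ))) : E d) j = ε * (y j + k j) :=
    cellMap_apply ε k y j
  rw [e, ← mul_sub, abs_mul, abs_of_pos hε] at hm
  have h1 := lt_of_mul_lt_mul_left hm hε.le
  rw [abs_lt] at h1
  have h2 := hY hy j
  rcases le_or_gt m (k j) with h3 | h3
  · have : (m : ℝ) ≤ k j := by exact_mod_cast h3
    linarith [h1.2, h2.1]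
  · have : (k j : ℝ) + 1 ≤ m := by exact_mod_cast h3
    linarith [h1.1, h2.2]

/-- A Sobolev function vanishing off a bounded set is estimated by translating out of the set. -/
theorem IsSobolev.lintegral_le_of_translate_out {Ω M : Set (E d)} (hΩ : IsOpen Ω) (hM : IsOpen M)
    {F : E d → ℝ} {g : E d → E d} (hF : IsSobolev M F g) (h0 : ∀ x ∉ Ω, F x = 0) {ρ : ℝ}
    (hρ : ∀ x ∈ Ω, ∀ y ∈ Ω, dist x y < ρ) {h : E d} (hh : ‖h‖ = ρ) {A : Set (E d)}
    (hA : ∀ y ∈ A, segment ℝ y (y + h) ⊆ M) :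
    ∫⁻ x in A, ‖F x‖ₑ ^ 2 ≤ 2 * ENNReal.ofReal ρ ^ 2 * ∫⁻ x in M, ‖g x‖ₑ ^ 2 := by
  have hz := lintegral_compl_eq_zero hΩ h0
  -- Only `A ∩ Ω` matters, and its translate misses `Ω` because `‖h‖ = ρ` exceeds every distance in
  -- `Ω`.
  have h1 : ∫⁻ x in A, ‖F x‖ₑ ^ 2 ≤ ∫⁻ x in A ∩ Ω, ‖F x‖ₑ ^ 2 := by
    calc _ ≤ ∫⁻ x in (A ∩ Ω) ∪ Ωᶜ, ‖F x‖ₑ ^ 2 := lintegral_mono_set fun x hx => by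
          by_cases h : x ∈ Ω
          · exact Or.inl ⟨hx, h⟩
          · exact Or.inr h
      _ ≤ _ := (lintegral_union_le _ _ _).trans (by rw [hz, add_zero])
  have h2 := hF.lintegral_le_translate hM (A := A ∩ Ω) (h := h) fun y hy => hA y hy.1
  have h3 : ∫⁻ x in (fun y => y + h) '' (A ∩ Ω), ‖F x‖ₑ ^ 2 = 0 := by
    refine le_antisymm ((lintegral_mono_set ?_).trans hz.le) (zero_le)
    rintro _ ⟨y, ⟨_, hy⟩, rfl⟩ hy'
    have := hρ _ hy' _ hy
    rw [dist_eq_norm, add_sub_cancel_left, hh] at this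
    exact lt_irrefl _ this
  rw [h3, mul_zero, zero_add, hh] at h2
  exact h1.trans h2

theorem segment_subset_slab {ε δ : ℝ} {i j : Fin d} (hij : i ≠ j) (c : ℝ) {y : E d}
    (hy : y ∈ slab ε δ j) :
    segment ℝ y (y + c • EuclideanSpace.single i 1) ⊆ slab ε δ j := by
  rw [segment_eq_image', add_sub_cancel_left]
  rintro _ ⟨t, _, rfl⟩
  obtain ⟨m, hm⟩ := hy
  refine ⟨m, ?_⟩
  have : (y + t • c • EuclideanSpace.single i (1 : ℝ) : E d) j = y j := by
    simp [hij.symm]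
  rwa [this]

theorem cellMap_image_subset_slab {ε δ : ℝ} (hε : 0 < ε) (k : Fin d → ℤ) :
    cellMap ε k '' (unitCell d \ core d δ) ⊆ ⋃ j, slab ε δ j := by
  rintro _ ⟨y, ⟨hy, hyc⟩, rfl⟩
  have : ∃ j, ¬ (δ ≤ y j ∧ y j ≤ 1 - δ) := by
    by_contra! h
    exact hyc h
  obtain ⟨j, hj⟩ := this
  refine mem_iUnion.2 ⟨j, ?_⟩
  rw [slab, mem_ofPred_eq]
  by_cases h1 : δ ≤ y j
  -- Here the point is near the upper face, so the nearby grid plane is that of the next cell.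
  · refine ⟨k j + 1, ?_⟩
    have h2 : 1 - δ < y j := not_le.1 fun h => hj ⟨h1, h⟩
    rw [cellMap_apply, ← mul_sub, abs_mul, abs_of_pos hε]
    refine mul_lt_mul_of_pos_left ?_ hε
    push_cast
    rw [abs_lt]
    constructor <;> linarith [(hy j).2]
  · refine ⟨k j, ?_⟩
    rw [cellMap_apply, ← mul_sub, abs_mul, abs_of_pos hε]
    refine mul_lt_mul_of_pos_left ?_ hε
    rw [add_sub_cancel_right, abs_of_pos (hy j).1]
    exact not_le.1 h1

/-- Points with a coordinate in `εℤ` lie on a grid plane; the integer parts of the coordinates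
divided by `ε` give the cell of all other points. -/
theorem mem_slab_or_cell {ε δ : ℝ} (hε : 0 < ε) (hδ : 0 < δ) (x : E d) :
    x ∈ (⋃ j, slab ε δ j) ∪ ⋃ k, cellMap ε k '' unitCell d := by
  by_cases h : ∃ (j : Fin d) (m : ℤ), x j = ε * m
  · obtain ⟨j, m, hm⟩ := h
    refine Or.inl (mem_iUnion.2 ⟨j, m, ?_⟩)
    rw [hm, sub_self, abs_zero]
    positivity
  · push Not at h
    refine Or.inr (mem_iUnion.2 ⟨fun j => ⌊ε⁻¹ * x j⌋,
      WithLp.toLp 2 (fun j => Int.fract (ε⁻¹ * x j)), fun j => ⟨?_, Int.fract_lt_one _⟩, ?_⟩)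
    · refine lt_of_le_of_ne (Int.fract_nonneg _) fun h0 => ?_
      have h1 := Int.floor_add_fract (ε⁻¹ * x j)
      rw [show Int.fract (ε⁻¹ * x j) = 0 from h0.symm, add_zero] at h1
      refine h j ⌊ε⁻¹ * x j⌋ ?_
      rw [h1, mul_inv_cancel_left₀ hε.ne']
    · ext j
      rw [cellMap_apply, add_comm]
      change ε * ((⌊ε⁻¹ * x j⌋ : ℝ) + Int.fract (ε⁻¹ * x j)) = x j
      rw [Int.floor_add_fract, mul_inv_cancel_left₀ hε.ne']

theorem lintegral_enorm_sq_smul (ε : ℝ) (A : Set (E d)) (g : E d → E d) :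
    ∫⁻ y in A, ‖ε • g y‖ₑ ^ 2 = ‖ε‖ₑ ^ 2 * ∫⁻ y in A, ‖g y‖ₑ ^ 2 := by
  simp_rw [enorm_smul, mul_pow]
  exact lintegral_const_mul' _ _ (by simp)

/-- The cell estimate at scale `ε`. -/
theorem IsSobolev.lintegral_cell_le {M : Set (E d)} (hM : IsOpen M) {F : E d → ℝ}
    {g : E d → E d} (hF : IsSobolev M F g) {ε : ℝ} (hε : 0 < ε) (k : Fin d → ℤ)
    {N S : Set (E d)} (hN : N ⊆ cellMap ε k ⁻¹' M) {C : ℝ≥0}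
    (hC : ∀ F g, IsSobolev N F g →
      ∫⁻ x in N, ‖F x‖ₑ ^ 2 ≤ C * ((∫⁻ x in S, ‖F x‖ₑ ^ 2) + ∫⁻ x in N, ‖g x‖ₑ ^ 2)) :
    ∫⁻ x in cellMap ε k '' N, ‖F x‖ₑ ^ 2 ≤
      C * ((∫⁻ x in cellMap ε k '' S, ‖F x‖ₑ ^ 2) +
        ‖ε‖ₑ ^ 2 * ∫⁻ x in cellMap ε k '' N, ‖g x‖ₑ ^ 2) := by
  have hMo : IsOpen (cellMap ε k ⁻¹' M) := hM.preimage (cellHomeo hε.ne' k).continuous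
  have h := hC _ _ ((hF.comp_cellMap hε.ne' k).mono hMo hN)
  rw [lintegral_enorm_sq_smul ε N (fun y => g (cellMap ε k y)),
    setLIntegral_comp_cellMap hε.ne' k N (fun x => ‖F x‖ₑ ^ 2),
    setLIntegral_comp_cellMap hε.ne' k S (fun x => ‖F x‖ₑ ^ 2),
    setLIntegral_comp_cellMap hε.ne' k N (fun x => ‖g x‖ₑ ^ 2)] at h
  -- The Jacobian factor is common to all terms and cancels.
  refine (ENNReal.mul_le_mul_iff_right (cellFactor_ne_zero hε.ne')
    (show cellFactor d ε ≠ ⊤ from ENNReal.ofReal_ne_top)).1 (h.trans (le_of_eq ?_))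
  ring

theorem disjoint_cellMap_image {ε : ℝ} (hε : 0 < ε) {k l : Fin d → ℤ} (hkl : k ≠ l)
    {A B : Set (E d)} (hA : A ⊆ unitCell d) (hB : B ⊆ unitCell d) :
    Disjoint (cellMap ε k '' A) (cellMap ε l '' B) := by
  rw [Set.disjoint_left]
  rintro _ ⟨y, hy, rfl⟩ ⟨z, hz, hzy⟩
  exact hkl (cellMap_floor_unique hε (hA hy) (hB hz) hzy.symm)

/-- The slabs are estimated by translating out of `Ω`, the cells by their shells, which lie in the
slabs. The slab bound therefore enters once directly and `C` times through the cells, whence the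
factor `1 + C`. Cells cut by `∂Ω` need no special treatment since `F` lives on all of `M`. -/
theorem lintegral_poreSpace_le {Ω Y₀ : Set (E d)} (hd : 2 ≤ d) (hΩ : IsOpen Ω)
    {ε δ : ℝ} (hε : 0 < ε) (hδ : 0 < δ) (hY : closure Y₀ ⊆ core d δ) {ρ : ℝ} (hρ0 : 0 < ρ)
    (hρ : ∀ x ∈ Ω, ∀ y ∈ Ω, dist x y < ρ) {C : ℝ≥0}
    (hC₁ : ∀ F g, IsSobolev (unitCell d \ closure Y₀) F g →
      ∫⁻ x in unitCell d \ closure Y₀, ‖F x‖ₑ ^ 2 ≤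
        C * ((∫⁻ x in unitCell d \ core d δ, ‖F x‖ₑ ^ 2) +
          ∫⁻ x in unitCell d \ closure Y₀, ‖g x‖ₑ ^ 2))
    (hC₂ : ∀ F g, IsSobolev (unitCell d) F g →
      ∫⁻ x in unitCell d, ‖F x‖ₑ ^ 2 ≤
        C * ((∫⁻ x in unitCell d \ core d δ, ‖F x‖ₑ ^ 2) + ∫⁻ x in unitCell d, ‖g x‖ₑ ^ 2))
    {F : E d → ℝ} {g : E d → E d} (hF : IsSobolev (closure (skeleton Ω Y₀ ε))ᶜ F g)
    (h0 : ∀ x ∉ Ω, F x = 0) :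
    ∫⁻ x in poreSpace Ω Y₀ ε, ‖F x‖ₑ ^ 2 ≤
      ((1 + C) * (d * (2 * ENNReal.ofReal ρ ^ 2)) + C * ‖ε‖ₑ ^ 2) *
        ∫⁻ x in (closure (skeleton Ω Y₀ ε))ᶜ, ‖g x‖ₑ ^ 2 := by
  set M : Set (E d) := (closure (skeleton Ω Y₀ ε))ᶜ
  have hM : IsOpen M := isClosed_closure.isOpen_compl
  have hYu : Y₀ ⊆ unitCell d := (subset_closure.trans hY).trans (core_subset_unitCell hδ)
  set D := ∫⁻ x in M, ‖g x‖ₑ ^ 2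
  set W : Set (E d) := ⋃ j, slab ε δ j
  have hW : ∫⁻ x in W, ‖F x‖ₑ ^ 2 ≤ d * (2 * ENNReal.ofReal ρ ^ 2) * D := by
    calc _ ≤ ∑' j : Fin d, ∫⁻ x in slab ε δ j, ‖F x‖ₑ ^ 2 := lintegral_iUnion_le _ _
      _ ≤ ∑' j : Fin d, 2 * ENNReal.ofReal ρ ^ 2 * D := by
          refine ENNReal.tsum_le_tsum fun j => ?_
          -- The direction of translation must differ from the normal `j` of the slab; this is where
          -- `d ≥ 2` enters.
          have : Nontrivial (Fin d) := Fin.nontrivial_iff_two_le.2 hd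
          obtain ⟨i, hij⟩ := exists_ne j
          refine hF.lintegral_le_of_translate_out hΩ hM h0 hρ
            (h := ρ • EuclideanSpace.single i 1) ?_ fun y hy =>
              (segment_subset_slab hij ρ hy).trans
                (slab_subset_compl_closure_skeleton hε (subset_closure.trans hY) j)
          rw [norm_smul]
          simp [abs_of_pos hρ0]
      _ = _ := by
          rw [tsum_fintype, Finset.sum_const, Finset.card_univ, Fintype.card_fin, nsmul_eq_mul,
            ← mul_assoc]
  set N : (Fin d → ℤ) → Set (E d) := fun k => unitCell d ∩ cellMap ε k ⁻¹' M
  set S : Set (E d) := unitCell d \ core d δ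
  have hSo : IsOpen S := isOpen_unitCell.sdiff (isClosed_core δ)
  have hNo : ∀ k, IsOpen (N k) := fun k =>
    isOpen_unitCell.inter (hM.preimage (cellHomeo hε.ne' k).continuous)
  have hcell : ∀ k, ∫⁻ x in cellMap ε k '' N k, ‖F x‖ₑ ^ 2 ≤
      C * ((∫⁻ x in cellMap ε k '' S, ‖F x‖ₑ ^ 2) +
        ‖ε‖ₑ ^ 2 * ∫⁻ x in cellMap ε k '' N k, ‖g x‖ₑ ^ 2) := by
    intro k
    refine hF.lintegral_cell_le hM hε k inter_subset_right ?_
    by_cases hk : hole Y₀ ε k ⊆ Ω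
    · have e : unitCell d ∩ cellMap ε k ⁻¹' M = _ := unitCell_inter_preimage_poreSpace hYu hε hk
      rw [e]
      exact hC₁
    · have e : unitCell d ∩ cellMap ε k ⁻¹' M = _ :=
        unitCell_subset_preimage_of_not_hole hYu hε hk
      rw [e]
      exact hC₂
  have himo : ∀ k {A : Set (E d)}, IsOpen A → MeasurableSet (cellMap ε k '' A) := fun k A hA =>
    (isOpenMap_cellMap hε.ne' k A hA).measurableSet
  have hcover : poreSpace Ω Y₀ ε ⊆ W ∪ ⋃ k, cellMap ε k '' N k := by
    intro x hx
    rcases mem_slab_or_cell hε hδ x with h | h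
    · exact Or.inl h
    · obtain ⟨k, y, hy, rfl⟩ := mem_iUnion.1 h
      exact Or.inr (mem_iUnion.2 ⟨k, y, ⟨hy, hx.2⟩, rfl⟩)
  have hsumS : ∑' k, ∫⁻ x in cellMap ε k '' S, ‖F x‖ₑ ^ 2 ≤ ∫⁻ x in W, ‖F x‖ₑ ^ 2 := by
    rw [← lintegral_iUnion (fun k => himo k hSo)
      (fun k l hkl => disjoint_cellMap_image hε hkl sdiff_subset sdiff_subset)]
    exact lintegral_mono_set (iUnion_subset fun k => cellMap_image_subset_slab hε k)
  have hsumN : ∑' k, ∫⁻ x in cellMap ε k '' N k, ‖g x‖ₑ ^ 2 ≤ D := by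
    rw [← lintegral_iUnion (fun k => himo k (hNo k))
      (fun k l hkl => disjoint_cellMap_image hε hkl inter_subset_left inter_subset_left)]
    refine lintegral_mono_set (iUnion_subset fun k => ?_)
    rintro _ ⟨y, hy, rfl⟩
    exact hy.2
  calc ∫⁻ x in poreSpace Ω Y₀ ε, ‖F x‖ₑ ^ 2
      ≤ (∫⁻ x in W, ‖F x‖ₑ ^ 2) + ∑' k, ∫⁻ x in cellMap ε k '' N k, ‖F x‖ₑ ^ 2 := by
        refine (lintegral_mono_set hcover).trans ((lintegral_union_le _ _ _).trans ?_)
        gcongr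
        exact lintegral_iUnion_le _ _
    _ ≤ (∫⁻ x in W, ‖F x‖ₑ ^ 2) + ∑' k, C * ((∫⁻ x in cellMap ε k '' S, ‖F x‖ₑ ^ 2) +
          ‖ε‖ₑ ^ 2 * ∫⁻ x in cellMap ε k '' N k, ‖g x‖ₑ ^ 2) := by
        gcongr with k
        exact hcell k
    _ = (∫⁻ x in W, ‖F x‖ₑ ^ 2) + C * ((∑' k, ∫⁻ x in cellMap ε k '' S, ‖F x‖ₑ ^ 2) +
          ‖ε‖ₑ ^ 2 * ∑' k, ∫⁻ x in cellMap ε k '' N k, ‖g x‖ₑ ^ 2) := by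
        rw [ENNReal.tsum_mul_left, ENNReal.tsum_add, ENNReal.tsum_mul_left]
    _ ≤ d * (2 * ENNReal.ofReal ρ ^ 2) * D +
          C * (d * (2 * ENNReal.ofReal ρ ^ 2) * D + ‖ε‖ₑ ^ 2 * D) := by
        have h1 := hsumS.trans hW
        gcongr
    _ = _ := by ring

theorem exists_dist_lt {Ω : Set (E d)} (hΩb : Bornology.IsBounded Ω) :
    ∃ ρ > 0, ∀ x ∈ Ω, ∀ y ∈ Ω, dist x y < ρ := by
  obtain ⟨R, hR⟩ := Metric.isBounded_iff.1 hΩb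
  exact ⟨|R| + 1, by positivity, fun x hx y hy => by
    linarith [hR hx hy, le_abs_self R]⟩

theorem skeleton_eq_empty {Ω Y₀ : Set (E d)} {ε : ℝ}
    (h : ∀ k, hole Y₀ ε k ⊆ Ω → Y₀ = ∅) : skeleton Ω Y₀ ε = ∅ := by
  refine iUnion_eq_empty.2 fun k => iUnion_eq_empty.2 fun hk => ?_
  rw [h k hk, hole, image_empty]

/-- Without perforations the Poincaré constant depends on the diameter only. -/
theorem lintegral_le_of_skeleton_eq_empty {Ω Y₀ : Set (E d)} (hd : 0 < d) (hΩ : IsOpen Ω) {ε : ℝ}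
    (hS : skeleton Ω Y₀ ε = ∅) {ρ : ℝ} (hρ0 : 0 < ρ) (hρ : ∀ x ∈ Ω, ∀ y ∈ Ω, dist x y < ρ)
    {F : E d → ℝ} {g : E d → E d} (hF : IsSobolev (closure (skeleton Ω Y₀ ε))ᶜ F g)
    (h0 : ∀ x ∉ Ω, F x = 0) :
    ∫⁻ x in poreSpace Ω Y₀ ε, ‖F x‖ₑ ^ 2 ≤
      2 * ENNReal.ofReal ρ ^ 2 * ∫⁻ x in (closure (skeleton Ω Y₀ ε))ᶜ, ‖g x‖ₑ ^ 2 := by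
  refine hF.lintegral_le_of_translate_out hΩ isClosed_closure.isOpen_compl h0 hρ
    (h := ρ • EuclideanSpace.single ⟨0, hd⟩ 1) ?_ fun y _ => ?_
  · rw [norm_smul]
    simp [abs_of_pos hρ0]
  · simp [hS]

theorem exists_uniform_isPoincareConstant {Ω Y₀ : Set (E d)} (hd : 2 ≤ d)
    (hΩ : IsOpen Ω) (hΩb : Bornology.IsBounded Ω) (hY₀ : IsOpen Y₀)
    (hY : closure Y₀ ⊆ unitCell d) :
    ∃ C, ∀ ε, AdmissibleScale Ω Y₀ ε → IsPoincareConstant Ω Y₀ ε C := by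
  have hd0 : 0 < d := by omega
  obtain ⟨ρ, hρ0, hρ⟩ := exists_dist_lt hΩb
  -- Unless some admissible scale has a nonempty perforation in `Ω`, no skeleton ever appears.
  -- Otherwise that one scale provides the geometry of the unit cell for all scales.
  by_cases hex : ∃ ε₀, AdmissibleScale Ω Y₀ ε₀ ∧ ∃ k, hole Y₀ ε₀ k ⊆ Ω ∧ Y₀ ≠ ∅
  swap
  · refine ⟨((2 * ρ.toNNReal ^ 2 : ℝ≥0) : ℝ), fun ε hε => isPoincareConstant_of_sobolev hΩ hε
      (by have := Real.toNNReal_pos.2 hρ0; positivity) fun F g hF h0 => ?_⟩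
    have hS : skeleton Ω Y₀ ε = ∅ := skeleton_eq_empty fun k hk => by
      by_contra hne
      exact hex ⟨ε, hε, k, hk, hne⟩
    push_cast
    exact lintegral_le_of_skeleton_eq_empty hd0 hΩ hS hρ0 hρ hF h0
  obtain ⟨ε₀, hε₀, k₀, hk₀, hne⟩ := hex
  obtain ⟨y₁, hy₁⟩ := nonempty_iff_ne_empty.2 hne
  have hcomp : IsCompact (closure Y₀) :=
    (isBounded_unitCell.subset (subset_closure.trans hY)).isCompact_closure
  obtain ⟨δ, hδ, hδ1, hcore⟩ := exists_subset_core hcomp hY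
  obtain ⟨C₁, hC₁⟩ := hε₀.controlled_cell hd0 hΩ hΩb hY₀ hδ hcore hk₀
  obtain ⟨C₂, hC₂⟩ := controlled_unitCell (d := d) hd0 hδ hδ1
  obtain ⟨r, hr, hball⟩ := Metric.isOpen_iff.1 hY₀ y₁ hy₁
  set y₂ : E d := y₁ + (r / 2) • EuclideanSpace.single ⟨0, hd0⟩ 1
  have hdist : dist y₂ y₁ = r / 2 := by
    rw [dist_eq_norm, add_sub_cancel_left, norm_smul]
    simp [abs_of_pos hr]
  have hy₂ : y₂ ∈ Y₀ := hball (by rw [Metric.mem_ball, hdist]; linarith)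
  -- `Y₀` contains two points at distance `r / 2`; if a scaled copy lies in `Ω`, then `ε r / 2 < ρ`.
  set εmax : ℝ := ρ / (r / 2)
  set C := C₁ + C₂
  have hC₁' : ∀ F g, IsSobolev (unitCell d \ closure Y₀) F g →
      ∫⁻ x in unitCell d \ closure Y₀, ‖F x‖ₑ ^ 2 ≤
        C * ((∫⁻ x in unitCell d \ core d δ, ‖F x‖ₑ ^ 2) +
          ∫⁻ x in unitCell d \ closure Y₀, ‖g x‖ₑ ^ 2) := fun F g hF =>
    (hC₁ F g hF).trans (mul_le_mul_left (by simp [C]) _)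
  have hC₂' : ∀ F g, IsSobolev (unitCell d) F g →
      ∫⁻ x in unitCell d, ‖F x‖ₑ ^ 2 ≤
        C * ((∫⁻ x in unitCell d \ core d δ, ‖F x‖ₑ ^ 2) + ∫⁻ x in unitCell d, ‖g x‖ₑ ^ 2) :=
    fun F g hF => (hC₂ F g hF).trans (mul_le_mul_left (by simp [C]) _)
  refine ⟨((2 * ρ.toNNReal ^ 2 + ((1 + C) * (d * (2 * ρ.toNNReal ^ 2)) +
    C * ‖εmax‖₊ ^ 2) : ℝ≥0) : ℝ), fun ε hε => isPoincareConstant_of_sobolev hΩ hε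
      (by have := Real.toNNReal_pos.2 hρ0; positivity) fun F g hF h0 => ?_⟩
  push_cast
  by_cases hk : ∃ k, hole Y₀ ε k ⊆ Ω
  · obtain ⟨k, hk⟩ := hk
    have hε1 : ε ≤ εmax := by
      have h1 := hρ _ (hk ⟨y₂, hy₂, rfl⟩) _ (hk ⟨y₁, hy₁, rfl⟩)
      rw [dist_eq_norm, ← smul_sub, norm_smul, add_sub_add_right_eq_sub, ← dist_eq_norm, hdist,
        Real.norm_eq_abs, abs_of_pos hε.pos] at h1
      rw [le_div_iff₀ (by linarith)]
      exact h1.le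
    have hε2 : ‖ε‖ₑ ≤ (‖εmax‖₊ : ℝ≥0∞) := by
      rw [enorm_eq_nnnorm, ENNReal.coe_le_coe, ← NNReal.coe_le_coe, coe_nnnorm, coe_nnnorm]
      exact abs_le_abs_of_nonneg hε.pos.le hε1
    refine (lintegral_poreSpace_le hd hΩ hε.pos hδ hcore hρ0 hρ hC₁' hC₂' hF h0).trans ?_
    refine mul_le_mul_left (le_trans ?_ le_add_self) _
    change _ ≤ (1 + (C : ℝ≥0∞)) * (d * (2 * ENNReal.ofReal ρ ^ 2)) + C * (‖εmax‖₊ : ℝ≥0∞) ^ 2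
    gcongr
  · have hS : skeleton Ω Y₀ ε = ∅ := skeleton_eq_empty fun k h => absurd ⟨k, h⟩ hk
    refine (lintegral_le_of_skeleton_eq_empty hd0 hΩ hS hρ0 hρ hF h0).trans ?_
    exact mul_le_mul_left le_self_add _

/-! ### The Hilbert space structure of `V^ε` -/

/-- For a fixed test function, both sides of the weak gradient identity are inner products with
fixed `L²` functions, hence continuous. -/
theorem isClosed_H1 (G : Set (E d)) : IsClosed (H1 G : Set (L2Pair G)) := by
  have e : (H1 G : Set (L2Pair G)) = {p | IsWeakGradient G p.1 p.2} := rfl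
  rw [e]
  simp only [IsWeakGradient, ofPred_forall]
  refine isClosed_iInter fun φ => isClosed_iInter fun h1 => isClosed_iInter fun h2 =>
    isClosed_iInter fun _ => isClosed_iInter fun j => ?_
  have m1 : MemLp (fun x => fderiv ℝ φ x (EuclideanSpace.single j 1)) 2 (volume.restrict G) :=
    ((continuous_dir h1 _).memLp_of_hasCompactSupport
      (hasCompactSupport_fderiv_apply h2 _)).restrict G
  have m2 : MemLp (fun x => φ x • EuclideanSpace.single j (1 : ℝ)) 2 (volume.restrict G) :=
    (ContinuousLinearMap.toSpanSingleton ℝ (EuclideanSpace.single j (1 : ℝ))).comp_memLp'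
      ((memLp_test h1 h2).restrict G)
  have e1 : ∀ p : L2Pair G, ∫ x in G, p.1 x * fderiv ℝ φ x (EuclideanSpace.single j 1) =
      inner ℝ (m1.toLp _) p.1 := by
    intro p
    rw [L2.inner_def]
    refine integral_congr_ae ?_
    filter_upwards [m1.coeFn_toLp] with x hx
    rw [hx]
    simp
  have e2 : ∀ p : L2Pair G, ∫ x in G, p.2 x j * φ x = inner ℝ (m2.toLp _) p.2 := by
    intro p
    rw [L2.inner_def]
    refine integral_congr_ae ?_
    filter_upwards [m2.coeFn_toLp] with x hx
    rw [hx, real_inner_smul_left, EuclideanSpace.inner_single_left]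
    simp [mul_comm]
  simp_rw [e1, e2]
  exact isClosed_eq (by fun_prop) (by fun_prop)

theorem isClosed_V (Ω Y₀ : Set (E d)) (ε : ℝ) :
    IsClosed (V Ω Y₀ ε : Set (L2Pair (poreSpace Ω Y₀ ε))) :=
  (isClosed_H1 _).inter (Submodule.isClosed_topologicalClosure _)

instance completeSpace_V (Ω Y₀ : Set (E d)) (ε : ℝ) : CompleteSpace (V Ω Y₀ ε) :=
  (isClosed_V Ω Y₀ ε).completeSpace_coe

variable {Ω Y₀ : Set (E d)} {ε : ℝ}

/-- The inclusion of `V^ε` into `L²`. -/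
def valL (Ω Y₀ : Set (E d)) (ε : ℝ) :
    V Ω Y₀ ε →L[ℝ] Lp ℝ 2 (volume.restrict (poreSpace Ω Y₀ ε)) :=
  (ContinuousLinearMap.fst ℝ _ _).comp (V Ω Y₀ ε).subtypeL

/-- The weak gradient as an operator on `V^ε`. -/
def gradL (Ω Y₀ : Set (E d)) (ε : ℝ) :
    V Ω Y₀ ε →L[ℝ] Lp (E d) 2 (volume.restrict (poreSpace Ω Y₀ ε)) :=
  (ContinuousLinearMap.snd ℝ _ _).comp (V Ω Y₀ ε).subtypeL

theorem coe_valL (v : V Ω Y₀ ε) : (valL Ω Y₀ ε v : E d → ℝ) = val v := rfl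

theorem coe_gradL (v : V Ω Y₀ ε) : (gradL Ω Y₀ ε v : E d → E d) = grad v := rfl

theorem IsPoincareConstant.norm_valL_le {C : ℝ} (hC : IsPoincareConstant Ω Y₀ ε C)
    (v : V Ω Y₀ ε) : ‖valL Ω Y₀ ε v‖ ≤ √C * ‖gradL Ω Y₀ ε v‖ := by
  have h := hC.2 v
  rw [← coe_valL, ← coe_gradL, integral_norm_sq_eq] at h
  have h2 := integral_norm_sq_eq (valL Ω Y₀ ε v)
  simp only [Real.norm_eq_abs, sq_abs] at h2
  rw [h2] at h
  refine le_of_sq_le_sq ?_ (by positivity)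
  rw [mul_pow, Real.sq_sqrt hC.1.le]
  exact h

/-- The norm inherited by `V^ε` is the maximum of the `L²` norms of function and gradient, and
Poincaré bounds the first by the second. This makes the space of gradients closed. -/
theorem IsPoincareConstant.antilipschitz {C : ℝ} (hC : IsPoincareConstant Ω Y₀ ε C) :
    AntilipschitzWith (Real.toNNReal (√C) + 1) (gradL Ω Y₀ ε) := by
  refine ContinuousLinearMap.antilipschitz_of_bound _ fun v => ?_
  have h1 := hC.norm_valL_le v
  have h2 : ‖v‖ = max ‖valL Ω Y₀ ε v‖ ‖gradL Ω Y₀ ε v‖ := rfl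
  rw [h2, NNReal.coe_add, Real.coe_toNNReal _ (Real.sqrt_nonneg _), NNReal.coe_one]
  have h3 := norm_nonneg (gradL Ω Y₀ ε v)
  have h4 := Real.sqrt_nonneg C
  refine max_le ?_ ?_ <;> nlinarith

/-- The space of weak gradients of functions in `V^ε`. -/
abbrev gradRange (Ω Y₀ : Set (E d)) (ε : ℝ) :
    Submodule ℝ (Lp (E d) 2 (volume.restrict (poreSpace Ω Y₀ ε))) :=
  LinearMap.range (gradL Ω Y₀ ε).toLinearMap

theorem IsPoincareConstant.isClosed_gradRange {C : ℝ} (hC : IsPoincareConstant Ω Y₀ ε C) :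
    IsClosed (gradRange Ω Y₀ ε : Set (Lp (E d) 2 (volume.restrict (poreSpace Ω Y₀ ε)))) := by
  have := hC.antilipschitz.isClosed_range (gradL Ω Y₀ ε).uniformContinuous
  simpa [gradRange, LinearMap.coe_range] using this

/-- `V^ε` is isomorphic to its space of gradients. -/
def IsPoincareConstant.equiv {C : ℝ} (hC : IsPoincareConstant Ω Y₀ ε C) :
    V Ω Y₀ ε ≃L[ℝ] gradRange Ω Y₀ ε :=
  ContinuousLinearMap.equivRange hC.antilipschitz.injective (by
    have := hC.isClosed_gradRange
    simpa [gradRange, LinearMap.coe_range] using this)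

theorem IsPoincareConstant.coe_equiv {C : ℝ} (hC : IsPoincareConstant Ω Y₀ ε C) (v : V Ω Y₀ ε) :
    (hC.equiv v : Lp (E d) 2 (volume.restrict (poreSpace Ω Y₀ ε))) = gradL Ω Y₀ ε v := rfl

theorem vNorm_eq {N : ℕ} (u : VProd Ω Y₀ ε N) :
    vNorm u = √(∑ i, ‖gradL Ω Y₀ ε (u i)‖ ^ 2) := by
  unfold vNorm
  congr 1
  refine Finset.sum_congr rfl fun i _ => ?_
  rw [← integral_norm_sq_eq, coe_gradL]

theorem vNorm_nonneg {N : ℕ} (u : VProd Ω Y₀ ε N) : 0 ≤ vNorm u := Real.sqrt_nonneg _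

theorem IsPoincareConstant.eq_zero_of_vNorm_le_zero {C : ℝ} (hC : IsPoincareConstant Ω Y₀ ε C)
    {N : ℕ} {u : VProd Ω Y₀ ε N} (hu : vNorm u ≤ 0) : u = 0 := by
  rw [vNorm_eq, Real.sqrt_le_left le_rfl] at hu
  have h1 : ∑ i, ‖gradL Ω Y₀ ε (u i)‖ ^ 2 = 0 :=
    le_antisymm (by simpa using hu) (Finset.sum_nonneg fun i _ => by positivity)
  rw [Finset.sum_eq_zero_iff_of_nonneg fun i _ => by positivity] at h1
  funext i
  refine hC.antilipschitz.injective ?_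
  have := h1 i (Finset.mem_univ i)
  rw [pow_eq_zero_iff two_ne_zero, norm_eq_zero] at this
  rw [this]
  simp

/-! ### The linear problem -/

/-- The operator of multiplication by a bounded matrix field. -/
def mulL {μ : Measure (E d)} {A : E d → E d →L[ℝ] E d} (hA : MemLp A ⊤ μ) :
    Lp (E d) 2 μ →L[ℝ] Lp (E d) 2 μ :=
  (ContinuousLinearMap.id ℝ (E d →L[ℝ] E d)).holderL μ ⊤ 2 2 (hA.toLp A)

theorem coeFn_mulL {μ : Measure (E d)} {A : E d → E d →L[ℝ] E d} (hA : MemLp A ⊤ μ)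
    (g : Lp (E d) 2 μ) : mulL hA g =ᵐ[μ] fun x => A x (g x) := by
  have h := (ContinuousLinearMap.id ℝ (E d →L[ℝ] E d)).coeFn_holder (r := 2) (hA.toLp A) g
  filter_upwards [h, hA.coeFn_toLp] with x h1 h2
  have h3 : mulL hA g x = (hA.toLp A x) (g x) := h1
  rw [h3, h2]

theorem inner_mulL {μ : Measure (E d)} {A : E d → E d →L[ℝ] E d} (hA : MemLp A ⊤ μ)
    (g h : Lp (E d) 2 μ) : inner ℝ (mulL hA g) h = ∫ x, inner ℝ (A x (g x)) (h x) ∂μ := by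
  rw [L2.inner_def]
  refine integral_congr_ae ?_
  filter_upwards [coeFn_mulL hA g] with x hx
  rw [hx]

theorem le_inner_mulL {μ : Measure (E d)} {A : E d → E d →L[ℝ] E d} (hA : MemLp A ⊤ μ) {α : ℝ}
    (hα : ∀ᵐ x ∂μ, ∀ ξ : E d, α * ‖ξ‖ ^ 2 ≤ inner ℝ (A x ξ) ξ) (g : Lp (E d) 2 μ) :
    α * ‖g‖ ^ 2 ≤ inner ℝ (mulL hA g) g := by
  rw [← integral_norm_sq_eq, ← integral_const_mul, L2.inner_def]
  refine integral_mono_ae ?_ (L2.integrable_inner _ _) ?_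
  · have := (L2.integrable_inner (𝕜 := ℝ) g g).const_mul α
    simpa only [real_inner_self_eq_norm_sq] using this
  · filter_upwards [hα, coeFn_mulL hA g] with x h1 h2
    rw [h2]
    exact h1 _

/-- The bilinear equation in terms of the operators. -/
theorem integral_equation_eq {A : E d → E d →L[ℝ] E d}
    (hA : MemLp A ⊤ (volume.restrict (poreSpace Ω Y₀ ε))) {f : E d → ℝ}
    (hf : MemLp f 2 (volume.restrict (poreSpace Ω Y₀ ε))) (u ψ : V Ω Y₀ ε) :
    ∫ x in poreSpace Ω Y₀ ε, (inner ℝ (A x (grad u x)) (grad ψ x) - f x * val ψ x) =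
      inner ℝ (mulL hA (gradL Ω Y₀ ε u)) (gradL Ω Y₀ ε ψ) -
        inner ℝ (hf.toLp f) (valL Ω Y₀ ε ψ) := by
  have i1 : Integrable (fun x => inner ℝ (A x (grad u x)) (grad ψ x))
      (volume.restrict (poreSpace Ω Y₀ ε)) := by
    refine (L2.integrable_inner (𝕜 := ℝ) (mulL hA (gradL Ω Y₀ ε u)) (gradL Ω Y₀ ε ψ)).congr ?_
    filter_upwards [coeFn_mulL hA (gradL Ω Y₀ ε u)] with x hx
    rw [hx]
    rfl
  have i2 : Integrable (fun x => f x * val ψ x) (volume.restrict (poreSpace Ω Y₀ ε)) :=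
    hf.integrable_mul (Lp.memLp (valL Ω Y₀ ε ψ))
  rw [integral_sub i1 i2, inner_mulL, L2.inner_def]
  congr 1
  refine integral_congr_ae ?_
  filter_upwards [hf.coeFn_toLp] with x hx
  rw [hx, coe_valL]
  simp [mul_comm]

/-- The Lax–Milgram theorem. -/
theorem exists_eq_of_isCoercive {H : Type*} [NormedAddCommGroup H] [InnerProductSpace ℝ H]
    [CompleteSpace H] {B : H →L[ℝ] H →L[ℝ] ℝ} (hB : IsCoercive B) (ℓ : H →L[ℝ] ℝ) :
    ∃ w, ∀ z, B w z = ℓ z := by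
  refine ⟨hB.continuousLinearEquivOfBilin.symm ((InnerProductSpace.toDual ℝ H).symm ℓ),
    fun z => ?_⟩
  rw [← hB.continuousLinearEquivOfBilin_apply, ContinuousLinearEquiv.apply_symm_apply,
    InnerProductSpace.toDual_symm_apply]

/-- The weak form of the scalar linear problem is solvable. -/
theorem IsPoincareConstant.exists_solution {C : ℝ} (hC : IsPoincareConstant Ω Y₀ ε C)
    {A : E d → E d →L[ℝ] E d} (hA : MemLp A ⊤ (volume.restrict (poreSpace Ω Y₀ ε))) {α : ℝ}
    (hα0 : 0 < α) (hα : ∀ᵐ x ∂(volume.restrict (poreSpace Ω Y₀ ε)),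
      ∀ ξ : E d, α * ‖ξ‖ ^ 2 ≤ inner ℝ (A x ξ) ξ) {f : E d → ℝ}
    (hf : MemLp f 2 (volume.restrict (poreSpace Ω Y₀ ε))) :
    ∃ u : V Ω Y₀ ε, ∀ ψ : V Ω Y₀ ε,
      ∫ x in poreSpace Ω Y₀ ε, (inner ℝ (A x (grad u x)) (grad ψ x) - f x * val ψ x) = 0 := by
  have : CompleteSpace (gradRange Ω Y₀ ε) := hC.isClosed_gradRange.completeSpace_coe
  -- Lax–Milgram is applied to the space of gradients, since the maximum norm of `V^ε` does not come
  -- from an inner product.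
  set W := gradRange Ω Y₀ ε
  set B : W →L[ℝ] W →L[ℝ] ℝ := (innerSL ℝ).bilinearComp ((mulL hA).comp W.subtypeL) W.subtypeL
  have hB : ∀ w z : W, B w z = inner ℝ (mulL hA w) (z : Lp (E d) 2 _) := fun w z => rfl
  have hco : IsCoercive B := by
    refine ⟨α, hα0, fun w => ?_⟩
    rw [hB, mul_assoc, ← sq]
    exact le_inner_mulL hA hα w
  set ℓ : W →L[ℝ] ℝ := (innerSL ℝ (hf.toLp f)).comp ((valL Ω Y₀ ε).comp
    (hC.equiv.symm : W →L[ℝ] V Ω Y₀ ε))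
  obtain ⟨w, hw⟩ := exists_eq_of_isCoercive hco ℓ
  refine ⟨hC.equiv.symm w, fun ψ => ?_⟩
  have h1 := hw (hC.equiv ψ)
  have h2 : gradL Ω Y₀ ε (hC.equiv.symm w) = w := by
    rw [← hC.coe_equiv, ContinuousLinearEquiv.apply_symm_apply]
  have h3 : ℓ (hC.equiv ψ) = inner ℝ (hf.toLp f) (valL Ω Y₀ ε ψ) := by
    change inner ℝ (hf.toLp f) (valL Ω Y₀ ε (hC.equiv.symm (hC.equiv ψ))) = _
    rw [ContinuousLinearEquiv.symm_apply_apply]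
  rw [integral_equation_eq hA hf, h2, ← h3, ← h1, hB, hC.coe_equiv, sub_self]

theorem grad_zero_ae : grad (0 : V Ω Y₀ ε) =ᵐ[volume.restrict (poreSpace Ω Y₀ ε)] 0 :=
  Lp.coeFn_zero _ _ _

theorem val_zero_ae : val (0 : V Ω Y₀ ε) =ᵐ[volume.restrict (poreSpace Ω Y₀ ε)] 0 :=
  Lp.coeFn_zero _ _ _

/-- The linear system decouples. -/
theorem solvesLinear_iff {N : ℕ} {D : Fin N → E d → (E d →L[ℝ] E d)} {f : Fin N → E d → ℝ}
    {u : VProd Ω Y₀ ε N} :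
    SolvesLinear D f u ↔ ∀ i (ψ : V Ω Y₀ ε), ∫ x in poreSpace Ω Y₀ ε,
      (inner ℝ (D i (ε⁻¹ • x) (grad (u i) x)) (grad ψ x) - f i x * val ψ x) = 0 := by
  constructor
  · intro h i ψ
    have h1 := h (Pi.single i ψ)
    rw [Finset.sum_eq_single i] at h1
    · simpa only [Pi.single_eq_same] using h1
    · intro j _ hj
      refine integral_eq_zero_of_ae ?_
      rw [Pi.single_eq_of_ne hj]
      filter_upwards [grad_zero_ae (Ω := Ω) (Y₀ := Y₀) (ε := ε),
        val_zero_ae (Ω := Ω) (Y₀ := Y₀) (ε := ε)] with x hx hx'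
      rw [hx, hx']
      simp
    · simp
  · intro h φ
    exact Finset.sum_eq_zero fun i _ => h i (φ i)

/-! ### The reaction terms -/

/-- For simple functions the composition is a finite sum of indicators times `R(·, p)`; continuity
in `p` passes to the pointwise limit. -/
theorem aestronglyMeasurable_caratheodory {X : Type*} [MeasurableSpace X] {μ : Measure X} {N : ℕ}
    {R : X → (Fin N → ℝ) → ℝ} (hm : ∀ p, AEStronglyMeasurable (fun x => R x p) μ)
    (hc : ∀ᵐ x ∂μ, Continuous (R x)) {u : X → Fin N → ℝ} (hu : AEStronglyMeasurable u μ) :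
    AEStronglyMeasurable (fun x => R x (u x)) μ := by
  classical
  obtain ⟨u', hu', huu'⟩ := hu
  have hs : ∀ s : SimpleFunc X (Fin N → ℝ), AEStronglyMeasurable (fun x => R x (s x)) μ := by
    intro s
    have e : (fun x => R x (s x)) =
        fun x => ∑ p ∈ s.range, (s ⁻¹' {p}).indicator (fun x => R x p) x := by
      ext x
      rw [Finset.sum_eq_single (s x)]
      · rw [indicator_of_mem (by simp)]
      · intro p _ hp
        exact indicator_of_notMem (fun h => hp h.symm) _
      · exact fun h => absurd (s.mem_range_self x) h
    rw [e]
    exact Finset.aestronglyMeasurable_fun_sum _ fun p _ =>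
      (hm p).indicator (s.measurableSet_fiber p)
  refine (aestronglyMeasurable_of_tendsto_ae atTop (fun n => hs (hu'.approx n))
    (g := fun x => R x (u' x)) ?_).congr ?_
  · filter_upwards [hc] with x hx
    exact (hx.tendsto _).comp (hu'.tendsto_approx x)
  · filter_upwards [huu'] with x hx
    rw [hx]

theorem eLpNorm_le_of_abs_le_sum {X : Type*} [MeasurableSpace X] {μ : Measure X} {N : ℕ} {L : ℝ}
    (hL : 0 ≤ L) {f : X → ℝ} {h : Fin N → X → ℝ} (hh : ∀ j, MemLp (h j) 2 μ)
    (hf : ∀ᵐ x ∂μ, |f x| ≤ L * ∑ j, |h j x|) :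
    (eLpNorm f 2 μ).toReal ≤ L * ∑ j, (eLpNorm (h j) 2 μ).toReal := by
  have hfin : ∀ j ∈ Finset.univ, eLpNorm (h j) 2 μ ≠ ⊤ := fun j _ => (hh j).eLpNorm_ne_top
  have h1 : eLpNorm f 2 μ ≤ ENNReal.ofReal L * ∑ j, eLpNorm (h j) 2 μ := by
    calc _ ≤ ENNReal.ofReal L * eLpNorm (∑ j, fun x => |h j x|) 2 μ := by
          refine eLpNorm_le_mul_eLpNorm_of_ae_le_mul ?_ 2
          filter_upwards [hf] with x hx
          rw [Finset.sum_apply, Real.norm_eq_abs, Real.norm_eq_abs,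
            abs_of_nonneg (Finset.sum_nonneg fun j _ => abs_nonneg (h j x))]
          exact hx
      _ ≤ ENNReal.ofReal L * ∑ j, eLpNorm (fun x => |h j x|) 2 μ := by
          gcongr
          exact eLpNorm_sum_le (fun j _ => (hh j).abs.aestronglyMeasurable) (by norm_num)
      _ = _ := by
          congr 1
          refine Finset.sum_congr rfl fun j _ => ?_
          exact eLpNorm_norm (h j)
  have h2 := ENNReal.toReal_mono (ENNReal.mul_ne_top ENNReal.ofReal_ne_top
    (ENNReal.sum_ne_top.2 hfin)) h1
  rwa [ENNReal.toReal_mul, ENNReal.toReal_ofReal hL, ENNReal.toReal_sum hfin] at h2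

theorem memLp_val (v : V Ω Y₀ ε) : MemLp (val v) 2 (volume.restrict (poreSpace Ω Y₀ ε)) :=
  Lp.memLp (valL Ω Y₀ ε v)

/-- The Lipschitz bound gives linear growth around `R_i(·, 0)`, which is bounded and so in `L²` of
the bounded set. -/
theorem memLp_reaction (hΩb : Bornology.IsBounded Ω) {N : ℕ}
    {R : Fin N → E d → (Fin N → ℝ) → ℝ} {L : Fin N → ℝ}
    (hR : ∀ i, IsCaratheodory (poreSpace Ω Y₀ ε) (R i))
    (hL : ∀ i, IsGloballyLipschitz (poreSpace Ω Y₀ ε) (L i) (R i)) (u : VProd Ω Y₀ ε N)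
    (i : Fin N) : MemLp (reaction R u i) 2 (volume.restrict (poreSpace Ω Y₀ ε)) := by
  have hfin : IsFiniteMeasure (volume.restrict (poreSpace Ω Y₀ ε)) := ⟨by
    rw [Measure.restrict_apply_univ]
    exact (hΩb.subset inter_subset_left).measure_lt_top⟩
  obtain ⟨M, hM⟩ := (hR i).bounded 0
  have hmeas : AEStronglyMeasurable (reaction R u i) (volume.restrict (poreSpace Ω Y₀ ε)) :=
    aestronglyMeasurable_caratheodory (hR i).measurable (hR i).continuous
      (aemeasurable_pi_lambda _ fun j =>
        (memLp_val (u j)).aestronglyMeasurable.aemeasurable).aestronglyMeasurable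
  have hb : MemLp (fun x => M + L i * ∑ j, |val (u j) x|) 2
      (volume.restrict (poreSpace Ω Y₀ ε)) :=
    (memLp_const M).add ((memLp_finsetSum _ fun j _ => (memLp_val (u j)).abs).const_mul (L i))
  refine hb.mono' hmeas ?_
  filter_upwards [hM, (hL i).2] with x h1 h2
  have h3 := h2 (fun j => val (u j) x) 0
  simp only [Pi.zero_apply, sub_zero] at h3
  have h4 := abs_sub_abs_le_abs_sub (R i x fun j => val (u j) x) (R i x 0)
  rw [Real.norm_eq_abs]
  change |R i x fun j => val (u j) x| ≤ _
  linarith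

theorem norm_reaction_sub_le {N : ℕ}
    {R : Fin N → E d → (Fin N → ℝ) → ℝ} {L : Fin N → ℝ}
    (hL : ∀ i, IsGloballyLipschitz (poreSpace Ω Y₀ ε) (L i) (R i)) (u w : VProd Ω Y₀ ε N)
    (i : Fin N) (hu : MemLp (reaction R u i) 2 (volume.restrict (poreSpace Ω Y₀ ε)))
    (hw : MemLp (reaction R w i) 2 (volume.restrict (poreSpace Ω Y₀ ε))) :
    ‖hu.toLp _ - hw.toLp _‖ ≤ L i * ∑ j, ‖valL Ω Y₀ ε ((u - w) j)‖ := by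
  rw [← MemLp.toLp_sub, Lp.norm_toLp]
  refine eLpNorm_le_of_abs_le_sum (hL i).1 (h := fun j => valL Ω Y₀ ε ((u - w) j))
    (fun j => Lp.memLp _) ?_
  have h1 : ∀ᵐ x ∂(volume.restrict (poreSpace Ω Y₀ ε)), ∀ j,
      valL Ω Y₀ ε ((u - w) j) x = val (u j) x - val (w j) x := by
    refine ae_all_iff.2 fun j => ?_
    rw [Pi.sub_apply, map_sub]
    exact Lp.coeFn_sub _ _
  filter_upwards [h1, (hL i).2] with x h2 h3
  simp_rw [h2]
  exact h3 _ _

/-! ### The diffusion matrices at scale `ε` -/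

theorem IsDiffusion.memLp_scaled {α : ℝ} {A : E d → E d →L[ℝ] E d} (hA : IsDiffusion α A)
    (hε : 0 < ε) (G : Set (E d)) :
    MemLp (fun x => A (ε⁻¹ • x)) ⊤ (volume.restrict G) := by
  have hq := Measure.quasiMeasurePreserving_smul (volume : Measure (E d)) (inv_ne_zero hε.ne')
  refine MemLp.restrict G (memLp_top_of_bound
    (hA.bounded.aestronglyMeasurable.comp_quasiMeasurePreserving hq)
    (eLpNormEssSup A volume).toReal ?_)
  have hfin : eLpNormEssSup A volume ≠ ⊤ := by
    have := hA.bounded.eLpNorm_ne_top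
    rwa [eLpNorm_exponent_top] at this
  filter_upwards [hq.ae (ae_le_eLpNormEssSup (f := A) (μ := volume))] with x hx
  have := ENNReal.toReal_mono hfin hx
  simpa using this

theorem IsDiffusion.elliptic_scaled {α : ℝ} {A : E d → E d →L[ℝ] E d} (hA : IsDiffusion α A)
    (hε : 0 < ε) (G : Set (E d)) : ∀ᵐ x ∂(volume.restrict G),
      ∀ ξ : E d, α * ‖ξ‖ ^ 2 ≤ inner ℝ (A (ε⁻¹ • x) ξ) ξ := by
  have hq := Measure.quasiMeasurePreserving_smul (volume : Measure (E d)) (inv_ne_zero hε.ne')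
  exact ae_restrict_of_ae (hq.ae hA.elliptic)

/-! ### The Picard iteration -/

/-- The factor `N` is `√N · √N`: one root from Cauchy–Schwarz for the sum over `j`, the other from
summing the same bound over all `i`. -/
theorem sqrt_sum_sq_le {N : ℕ} {a b : Fin N → ℝ} {c : ℝ} (ha : ∀ i, 0 ≤ a i)
    (hc : 0 ≤ c) (hb : ∀ i, 0 ≤ b i) (h : ∀ i, a i ≤ c * ∑ j, b j) :
    √(∑ i, a i ^ 2) ≤ c * N * √(∑ j, b j ^ 2) := by
  have hB : 0 ≤ ∑ j, b j := Finset.sum_nonneg fun j _ => hb j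
  have h1 : (∑ j, b j) ^ 2 ≤ N * ∑ j, b j ^ 2 := by
    simpa using sq_sum_le_card_mul_sum_sq (s := Finset.univ) (f := b)
  have h2 : ∑ i, a i ^ 2 ≤ N * (c * ∑ j, b j) ^ 2 := by
    calc _ ≤ ∑ _i : Fin N, (c * ∑ j, b j) ^ 2 :=
          Finset.sum_le_sum fun i _ => pow_le_pow_left₀ (ha i) (h i) 2
      _ = _ := by simp
  rw [Real.sqrt_le_left (by positivity), mul_pow, mul_pow,
    Real.sq_sqrt (Finset.sum_nonneg fun j _ => by positivity)]
  calc _ ≤ N * (c * ∑ j, b j) ^ 2 := h2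
    _ = N * c ^ 2 * (∑ j, b j) ^ 2 := by ring
    _ ≤ N * c ^ 2 * (N * ∑ j, b j ^ 2) := by gcongr
    _ = _ := by ring

/-- Each use of Poincaré, on the test function and on the right-hand side, gives a `√C`; then one
power of the gradient norm `a` cancels. -/
theorem le_of_energy_estimate {α C l S a r v : ℝ} (hα : 0 < α) (hC : 0 ≤ C) (hl : 0 ≤ l)
    (hS : 0 ≤ S) (ha : 0 ≤ a) (hv0 : 0 ≤ v) (h : α * a ^ 2 ≤ r * v) (hv : v ≤ √C * a)
    (hr : r ≤ l * (√C * S)) : a ≤ C * α⁻¹ * l * S := by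
  have h8 : α * a ^ 2 ≤ (l * (√C * S)) * (√C * a) :=
    h.trans (mul_le_mul hr hv hv0 (by positivity))
  have h9 : α * a ^ 2 ≤ (C * l * S) * a := by
    refine h8.trans (le_of_eq ?_)
    have := Real.mul_self_sqrt hC
    linear_combination l * S * a * this
  have h10 : α * a ≤ C * l * S := by
    by_cases h0 : a = 0
    · rw [h0, mul_zero]
      positivity
    · refine le_of_mul_le_mul_right ?_ (lt_of_le_of_ne ha (Ne.symm h0))
      calc α * a * a = α * a ^ 2 := by ring
        _ ≤ _ := h9
  calc a = α⁻¹ * (α * a) := by rw [inv_mul_cancel_left₀ hα.ne']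
    _ ≤ α⁻¹ * (C * l * S) := by gcongr
    _ = _ := by ring

/-- The energy inequality for the difference of two solutions. -/
theorem energy_le_of_solutions {A : E d → E d →L[ℝ] E d}
    (hA : MemLp A ⊤ (volume.restrict (poreSpace Ω Y₀ ε))) {α : ℝ}
    (hα : ∀ᵐ x ∂(volume.restrict (poreSpace Ω Y₀ ε)),
      ∀ ξ : E d, α * ‖ξ‖ ^ 2 ≤ inner ℝ (A x ξ) ξ) {f g : E d → ℝ}
    (hf : MemLp f 2 (volume.restrict (poreSpace Ω Y₀ ε)))
    (hg : MemLp g 2 (volume.restrict (poreSpace Ω Y₀ ε))) {s t : V Ω Y₀ ε}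
    (hs : ∀ ψ : V Ω Y₀ ε,
      ∫ x in poreSpace Ω Y₀ ε, (inner ℝ (A x (grad s x)) (grad ψ x) - f x * val ψ x) = 0)
    (ht : ∀ ψ : V Ω Y₀ ε,
      ∫ x in poreSpace Ω Y₀ ε, (inner ℝ (A x (grad t x)) (grad ψ x) - g x * val ψ x) = 0) :
    α * ‖gradL Ω Y₀ ε (s - t)‖ ^ 2 ≤ ‖hf.toLp f - hg.toLp g‖ * ‖valL Ω Y₀ ε (s - t)‖ := by
  have h1 := hs (s - t)
  have h2 := ht (s - t)
  rw [integral_equation_eq hA hf] at h1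
  rw [integral_equation_eq hA hg] at h2
  have h3 : inner ℝ (mulL hA (gradL Ω Y₀ ε (s - t))) (gradL Ω Y₀ ε (s - t)) =
      inner ℝ (hf.toLp f - hg.toLp g) (valL Ω Y₀ ε (s - t)) := by
    have h4 : mulL hA (gradL Ω Y₀ ε (s - t)) =
        mulL hA (gradL Ω Y₀ ε s) - mulL hA (gradL Ω Y₀ ε t) := by
      rw [map_sub, map_sub]
    rw [h4, inner_sub_left, inner_sub_left]
    linarith
  exact (le_inner_mulL hA hα _).trans (h3.le.trans (real_inner_le_norm _ _))

/-- One step of the Picard iteration is a contraction. -/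
theorem vNorm_sub_le_of_solvesLinear (hΩb : Bornology.IsBounded Ω) (hε : 0 < ε) {C : ℝ}
    (hC : IsPoincareConstant Ω Y₀ ε C) {N : ℕ} {α : ℝ}
    {D : Fin N → E d → (E d →L[ℝ] E d)} (hα : 0 < α) (hD : ∀ i, IsDiffusion α (D i))
    {L : Fin N → ℝ} {R : Fin N → E d → (Fin N → ℝ) → ℝ}
    (hR : ∀ i, IsCaratheodory (poreSpace Ω Y₀ ε) (R i))
    (hL : ∀ i, IsGloballyLipschitz (poreSpace Ω Y₀ ε) (L i) (R i)) {u w s t : VProd Ω Y₀ ε N}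
    (hs : SolvesLinear D (reaction R u) s) (ht : SolvesLinear D (reaction R w) t) :
    vNorm (s - t) ≤ C * α⁻¹ * (⨆ i, L i) * N * vNorm (u - w) := by
  rw [solvesLinear_iff] at hs ht
  rw [vNorm_eq, vNorm_eq]
  have hLs : ∀ i, L i ≤ ⨆ i, L i := fun i => le_ciSup (Set.finite_range L).bddAbove i
  have hLs0 : 0 ≤ ⨆ i, L i := Real.iSup_nonneg fun i => (hL i).1
  have hC0 := hC.1
  refine sqrt_sum_sq_le (fun i => norm_nonneg _) (by positivity) (fun i => norm_nonneg _)
    fun i => ?_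
  have hu := memLp_reaction hΩb hR hL u i
  have hw := memLp_reaction hΩb hR hL w i
  have h7 : L i * ∑ j, ‖valL Ω Y₀ ε ((u - w) j)‖ ≤
      (⨆ i, L i) * (√C * ∑ j, ‖gradL Ω Y₀ ε ((u - w) j)‖) := by
    rw [Finset.mul_sum _ _ (√C)]
    refine mul_le_mul (hLs i) (Finset.sum_le_sum fun j _ => hC.norm_valL_le _)
      (Finset.sum_nonneg fun j _ => norm_nonneg _) hLs0
  exact le_of_energy_estimate hα hC0.le hLs0 (Finset.sum_nonneg fun j _ => norm_nonneg _)
    (norm_nonneg _) (norm_nonneg _)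
    (energy_le_of_solutions ((hD i).memLp_scaled hε (poreSpace Ω Y₀ ε))
      ((hD i).elliptic_scaled hε _) hu hw (hs i) (ht i))
    (hC.norm_valL_le _) ((norm_reaction_sub_le hL u w i hu hw).trans h7)

theorem exists_solvesLinear (hΩb : Bornology.IsBounded Ω) (hε : 0 < ε) {C : ℝ}
    (hC : IsPoincareConstant Ω Y₀ ε C) {N : ℕ} {α : ℝ}
    {D : Fin N → E d → (E d →L[ℝ] E d)} (hα : 0 < α) (hD : ∀ i, IsDiffusion α (D i))
    {L : Fin N → ℝ} {R : Fin N → E d → (Fin N → ℝ) → ℝ}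
    (hR : ∀ i, IsCaratheodory (poreSpace Ω Y₀ ε) (R i))
    (hL : ∀ i, IsGloballyLipschitz (poreSpace Ω Y₀ ε) (L i) (R i)) (u : VProd Ω Y₀ ε N) :
    ∃ s : VProd Ω Y₀ ε N, SolvesLinear D (reaction R u) s := by
  have h := fun i => hC.exists_solution ((hD i).memLp_scaled hε (poreSpace Ω Y₀ ε)) hα
    ((hD i).elliptic_scaled hε _) (memLp_reaction hΩb hR hL u i)
  choose s hs using h
  exact ⟨s, solvesLinear_iff.2 hs⟩

/-- Banach's fixed point theorem for a bijection onto a complete metric space. -/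
theorem exists_fixedPoint_of_equiv {X Y : Type*} [MetricSpace Y] [CompleteSpace Y] (e : X ≃ Y)
    {κ : ℝ} (hκ0 : 0 ≤ κ) (hκ : κ < 1) {T : X → X}
    (hT : ∀ u w, dist (e (T u)) (e (T w)) ≤ κ * dist (e u) (e w)) (x : X) :
    ∃ u, T u = u ∧ Tendsto (fun n => dist (e (T^[n] x)) (e u)) atTop (𝓝 0) ∧
      ∀ n, dist (e (T^[n] x)) (e u) ≤ κ ^ n / (1 - κ) * dist (e (T x)) (e x) := by
  have : Nonempty Y := ⟨e x⟩
  set F : Y → Y := fun y => e (T (e.symm y))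
  have hF : ContractingWith κ.toNNReal F := by
    refine ⟨by rwa [Real.toNNReal_lt_one], LipschitzWith.of_dist_le_mul fun y z => ?_⟩
    rw [Real.coe_toNNReal _ hκ0]
    simpa using hT (e.symm y) (e.symm z)
  have hit : ∀ n, F^[n] (e x) = e (T^[n] x) := by
    intro n
    induction n with
    | zero => rfl
    | succ n ih =>
      rw [Function.iterate_succ_apply', Function.iterate_succ_apply', ih]
      simp [F]
  refine ⟨e.symm (ContractingWith.fixedPoint F hF), ?_, ?_, fun n => ?_⟩
  · rw [e.eq_symm_apply]
    exact hF.fixedPoint_isFixedPt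
  · simp_rw [e.apply_symm_apply, ← hit]
    exact tendsto_iff_dist_tendsto_zero.1 (hF.tendsto_iterate_fixedPoint (e x))
  · have h1 := hF.apriori_dist_iterate_fixedPoint_le (e x) n
    rw [Real.coe_toNNReal _ hκ0, dist_comm (e x)] at h1
    have h2 : F (e x) = e (T x) := by simp [F]
    rw [h2, hit] at h1
    rw [e.apply_symm_apply]
    exact h1.trans (le_of_eq (by ring))

/-- `𝒱^ε` with its norm is isometric to a Hilbert space. -/
theorem IsPoincareConstant.exists_equiv {C : ℝ} (hC : IsPoincareConstant Ω Y₀ ε C) (N : ℕ) :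
    ∃ e : VProd Ω Y₀ ε N ≃ PiLp 2 (fun _ : Fin N => gradRange Ω Y₀ ε),
      ∀ u w, dist (e u) (e w) = vNorm (u - w) := by
  refine ⟨(Equiv.piCongrRight fun _ => hC.equiv.toEquiv).trans (WithLp.equiv 2 _).symm,
    fun u w => ?_⟩
  rw [vNorm_eq, PiLp.dist_eq_of_L2]
  congr 1
  refine Finset.sum_congr rfl fun i _ => ?_
  rw [Pi.sub_apply, map_sub, ← dist_eq_norm]
  rfl

/-- Banach's fixed point theorem in the norm of `𝒱^ε`. -/
theorem IsPoincareConstant.exists_fixedPoint {C : ℝ} (hC : IsPoincareConstant Ω Y₀ ε C) {N : ℕ}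
    {κ : ℝ} (hκ0 : 0 ≤ κ) (hκ : κ < 1) {T : VProd Ω Y₀ ε N → VProd Ω Y₀ ε N}
    (hT : ∀ u w, vNorm (T u - T w) ≤ κ * vNorm (u - w)) :
    ∃ u, T u = u ∧ Tendsto (fun n => vNorm (T^[n] 0 - u)) atTop (𝓝 0) ∧
      ∀ n, vNorm (T^[n] 0 - u) ≤ κ ^ n / (1 - κ) * vNorm (T 0) := by
  have hcompl : CompleteSpace (gradRange Ω Y₀ ε) := hC.isClosed_gradRange.completeSpace_coe
  obtain ⟨e, he⟩ := hC.exists_equiv N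
  have h := exists_fixedPoint_of_equiv e hκ0 hκ (T := T)
    (fun u w => by rw [he, he]; exact hT u w) 0
  simpa only [he, sub_zero] using h

/-- Unique solvability and convergence of the Picard iteration. -/
theorem IsPoincareConstant.exists_picard (hΩb : Bornology.IsBounded Ω) (hε : 0 < ε) {C : ℝ}
    (hC : IsPoincareConstant Ω Y₀ ε C) {N : ℕ} {α : ℝ}
    {D : Fin N → E d → (E d →L[ℝ] E d)} (hα : 0 < α) (hD : ∀ i, IsDiffusion α (D i))
    {L : Fin N → ℝ} {R : Fin N → E d → (Fin N → ℝ) → ℝ}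
    (hR : ∀ i, IsCaratheodory (poreSpace Ω Y₀ ε) (R i))
    (hL : ∀ i, IsGloballyLipschitz (poreSpace Ω Y₀ ε) (L i) (R i))
    {κ : ℝ} (hκ : κ = C * α⁻¹ * (⨆ i, L i) * N) (hκ1 : κ < 1) :
    ∃ u : VProd Ω Y₀ ε N, IsWeakSolution D R u ∧
      (∀ w : VProd Ω Y₀ ε N, IsWeakSolution D R w → w = u) ∧
      ∃ U : ℕ → VProd Ω Y₀ ε N, IsPicard D R U ∧
        (∀ W : ℕ → VProd Ω Y₀ ε N, IsPicard D R W → W = U) ∧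
        Tendsto (fun n => vNorm (U n - u)) atTop (𝓝 0) ∧
        ∀ n, vNorm (U n - u) ≤ κ ^ n / (1 - κ) * vNorm (U 1) := by
  have hC0 := hC.1
  have hκ0 : 0 ≤ κ := by
    have : 0 ≤ ⨆ i, L i := Real.iSup_nonneg fun i => (hL i).1
    rw [hκ]
    positivity
  have hcontr : ∀ {u w s t : VProd Ω Y₀ ε N}, SolvesLinear D (reaction R u) s →
      SolvesLinear D (reaction R w) t → vNorm (s - t) ≤ κ * vNorm (u - w) := by
    intro u w s t hs ht
    rw [hκ]
    exact vNorm_sub_le_of_solvesLinear hΩb hε hC hα hD hR hL hs ht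
  choose T hT using fun u => exists_solvesLinear hΩb hε hC hα hD hR hL u
  -- Uniqueness for the linear problem is the contraction estimate with equal right-hand sides; it
  -- makes the Picard sequence unique.
  have hTu : ∀ {u s : VProd Ω Y₀ ε N}, SolvesLinear D (reaction R u) s → s = T u := by
    intro u s hs
    have h1 := hcontr hs (hT u)
    have h2 : vNorm (u - u) = 0 := by
      rw [sub_self, vNorm_eq]
      simp
    rw [h2, mul_zero] at h1
    exact sub_eq_zero.1 (hC.eq_zero_of_vNorm_le_zero h1)
  obtain ⟨u, hu, hlim, hest⟩ := hC.exists_fixedPoint hκ0 hκ1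
    (fun u w => hcontr (hT u) (hT w))
  have husol : SolvesLinear D (reaction R u) u := by
    have := hT u
    rwa [hu] at this
  refine ⟨u, husol, fun w hw => ?_, fun n => T^[n] 0, ⟨rfl, fun n => ?_⟩, fun W hW => ?_, hlim,
    fun n => hest n⟩
  -- Both solutions are fixed points, so the norm of their difference is at most `κ < 1` times
  -- itself.
  · have h1 := hcontr hw husol
    have h2 := vNorm_nonneg (w - u)
    exact sub_eq_zero.1 (hC.eq_zero_of_vNorm_le_zero (by nlinarith))
  · simp only [Function.iterate_succ_apply']
    exact hT _
  · funext n
    induction n with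
    | zero => exact hW.1
    | succ n ih =>
      rw [Function.iterate_succ_apply', ← ih]
      exact hTu (hW.2 n)

end Perforated

end

theorem theorem9 (d : ℕ) (hd : 2 ≤ d)
    (Ω Y₀ : Set (Perforated.E d)) (hΩ : IsOpen Ω) (hΩb : Bornology.IsBounded Ω)
    (hY₀ : IsOpen Y₀) (hY₀Y : Y₀ ⊆ Perforated.unitCell d) :
    -- Poincaré constants exist; for strictly interior perforations one serves all scales
    (∀ ε, Perforated.AdmissibleScale Ω Y₀ ε → ∃ C, Perforated.IsPoincareConstant Ω Y₀ ε C) ∧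
    (closure Y₀ ⊆ Perforated.unitCell d → ∃ C, ∀ ε, Perforated.AdmissibleScale Ω Y₀ ε →
      Perforated.IsPoincareConstant Ω Y₀ ε C) ∧
    -- unique solvability, and convergence of the Picard iteration
    ∀ (ε : ℝ), Perforated.AdmissibleScale Ω Y₀ ε →
    ∀ (Cp : ℝ), Perforated.IsPoincareConstant Ω Y₀ ε Cp →
    ∀ (N : ℕ), 1 ≤ N →
    ∀ (α : ℝ) (D : Fin N → Perforated.E d → (Perforated.E d →L[ℝ] Perforated.E d)),
      0 < α → (∀ i, Perforated.IsDiffusion α (D i)) →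
    ∀ (L : Fin N → ℝ) (R : Fin N → Perforated.E d → (Fin N → ℝ) → ℝ),
      (∀ i, Perforated.IsCaratheodory (Perforated.poreSpace Ω Y₀ ε) (R i)) →
      (∀ i, Perforated.IsGloballyLipschitz (Perforated.poreSpace Ω Y₀ ε) (L i) (R i)) →
    ∀ (κ : ℝ), κ = Cp * α⁻¹ * (⨆ i, L i) * N → κ < 1 →
    ∃ u : Perforated.VProd Ω Y₀ ε N,
      Perforated.IsWeakSolution D R u ∧
      (∀ w : Perforated.VProd Ω Y₀ ε N, Perforated.IsWeakSolution D R w → w = u) ∧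
      ∃ U : ℕ → Perforated.VProd Ω Y₀ ε N,
        Perforated.IsPicard D R U ∧
        (∀ W : ℕ → Perforated.VProd Ω Y₀ ε N, Perforated.IsPicard D R W → W = U) ∧
        Filter.Tendsto (fun n => Perforated.vNorm (U n - u)) Filter.atTop (nhds 0) ∧
        ∀ n, Perforated.vNorm (U n - u) ≤ κ ^ n / (1 - κ) * Perforated.vNorm (U 1) := by
  have hd0 : 0 < d := by omega
  refine ⟨fun ε hε => hε.exists_isPoincareConstant hd0 hΩ hΩb hY₀, fun hcl =>
    Perforated.exists_uniform_isPoincareConstant hd hΩ hΩb hY₀ hcl, ?_⟩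
  intro ε hε Cp hCp N _ α D hα hD L R hR hL κ hκ hκ1
  exact hCp.exists_picard hΩb hε.pos hα hD hR hL hκ hκ1
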